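/- Graphs are finite and undirected, and may have loops and multiple edges. For a graph $G=(V,E)$ let $P_G(q)=\sum_{A\subseteq E}(-1)^{|A|}q^{k(A)}$ be its chromatic polynomial, where $k(A)$ is the number of connected components of $(V,A)$, isolated vertices included. A graph is 2-degenerate if every nonempty subgraph has a vertex of degree at most 2 in that subgraph. For an integer $s\ge 2$ put $$C_s(q)=\frac{(q-1)^s+(q-1)(-1)^s}{q},\qquad Q_s=\{q\in\mathbb C:\ |(q-1)^s+(q-1)(-1)^s|>|(q-1)^s-(-1)^s|\}.$$ (Note that $0\notin Q_s$, and that $C_s$ has no zero in $Q_s$.) Theorem B.1. Let $G$ be a loopless graph, and let $s$ be an integer $\ge 2$. Then there exist 2-degenerate (hence 3-colorable) graphs $\{G'(p)\}_{p=1}^\infty$ and an integer $k\ge 0$ such that (a) $\lim_{p\to\infty} C_s(q)^{-kp}\,P_{G'(p)}(q)=P_G(q)$ uniformly on compact subsets of $Q_s$. (b) If $G$ is connected, then so are the $G'(p)$. (c) If $s$ is even and $G$ is bipartite, then so are the $G'(p)$. (d) If $G$ is embeddable on a surface $S$ (a Hausdorff 2-dimensional topological manifold without boundary, compact or not), then so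 are the $G'(p)$. Here the $G'(p)$ do not depend on $S$. In particular: (i) If $q_0\in Q_s$ is a zero of $P_G$, then for all $\epsilon>0$ and all sufficiently large $p$ (depending on $\epsilon$), $P_{G'(p)}$ has a zero in the disc $|q-q_0|<\epsilon$. (ii) If $q_0\in Q_s\cap\mathbb R$ is a zero of $P_G$ of odd multiplicity, then for all $\epsilon>0$ and all sufficiently large $p$ (depending on $\epsilon$), $P_{G'(p)}$ has a zero in the interval $(q_0-\epsilon,q_0+\epsilon)$. -/

import Mathlib

open scoped Graph

/-! Finite undirected graphs, possibly with loops and multiple edges, are Mathlib's `Graph α β` with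
`V(G)` and `E(G)` finite. -/

universe u v w

namespace Graph

/-- The number `k(A)` of connected components (isolated vertices included) of the spanning subgraph
of `G` whose edges are those in `A`. -/
noncomputable def numComponents {α : Type u} {β : Type v} (G : Graph α β) (A : Set β) : ℕ :=
  Nat.card (G.restrict A).toSimpleGraph.ConnectedComponent

/-- The chromatic polynomial of a finite graph,
`P_G(q) = ∑_{A ⊆ E(G)} (-1)^{|A|} q^{k(A)}`. -/
noncomputable def chromaticPolynomial {α : Type u} {β : Type v} (G : Graph α β) : Polynomial ℤ :=
  ∑ᶠ A ∈ E(G).powerset, (-1) ^ A.ncard * Polynomial.X ^ G.numComponents A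

/-- The degree of a vertex: the number of edges at `x`, a loop being counted twice. -/
noncomputable def degree {α : Type u} {β : Type v} (G : Graph α β) (x : α) : ℕ∞ :=
  {e | G.IsNonloopAt e x}.encard + 2 * {e | G.IsLoopAt e x}.encard

/-- The minimum degree of a (nonempty) graph. -/
noncomputable def minDegree {α : Type u} {β : Type v} (G : Graph α β) : ℕ∞ :=
  ⨅ x ∈ V(G), G.degree x

/-- The degeneracy number: the maximum of the minimum degree over all (nonempty) subgraphs. -/
noncomputable def degeneracyNumber {α : Type u} {β : Type v} (G : Graph α β) : ℕ∞ :=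
  ⨆ (H : Graph α β) (_ : H ≤ G) (_ : V(H).Nonempty), H.minDegree

/-- A graph is `k`-degenerate if its degeneracy number is at most `k`. -/
def IsDegenerate {α : Type u} {β : Type v} (G : Graph α β) (k : ℕ) : Prop :=
  G.degeneracyNumber ≤ k

/-- `G` has a proper vertex colouring with `n` colours. -/
def Colorable {α : Type u} {β : Type v} (G : Graph α β) (n : ℕ) : Prop :=
  ∃ c : V(G) → Fin n, ∀ x y : V(G), G.Adj x y → c x ≠ c y

/-- A graph is bipartite if its vertices can be split into two classes such that every edge joins
the two classes. -/
def IsBipartite {α : Type u} {β : Type v} (G : Graph α β) : Prop :=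
  G.Colorable 2

/-- A graph is connected if it is nonempty and any two vertices are joined by a walk. -/
def IsConnected {α : Type u} {β : Type v} (G : Graph α β) : Prop :=
  G.toSimpleGraph.Connected

/-- `G` can be drawn on the space `S` without crossings: distinct vertices are distinct points, each
edge is a continuous arc joining its ends (a closed curve for a loop), no arc passes through a
vertex at an interior time, and no point is passed twice by interior points of arcs. -/
def EmbeddableOn {α : Type u} {β : Type v} (G : Graph α β) (S : Type w) [TopologicalSpace S] :
    Prop :=
  ∃ (pt : V(G) → S) (arc : E(G) → C(unitInterval, S)),
    Function.Injective pt ∧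
    (∀ (e : E(G)) (x y : V(G)), G.IsLink e x y → s(arc e 0, arc e 1) = s(pt x, pt y)) ∧
    (∀ (e : E(G)), ∀ t ∈ Set.Ioo (0 : unitInterval) 1, ∀ x : V(G), arc e t ≠ pt x) ∧
    (∀ (e f : E(G)), ∀ t ∈ Set.Ioo (0 : unitInterval) 1, ∀ t' ∈ Set.Ioo (0 : unitInterval) 1,
      arc e t = arc f t' → e = f ∧ t = t')

end Graph

/-- `C_s(q) = ((q-1)^s + (q-1)(-1)^s) / q`, for `q ≠ 0`. -/
noncomputable def cycleFactor (s : ℕ) (q : ℂ) : ℂ :=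
  ((q - 1) ^ s + (q - 1) * (-1) ^ s) / q

/-- The set `Q_s` of all `q` with `|(q-1)^s + (q-1)(-1)^s| > |(q-1)^s - (-1)^s|`; it does not
contain `0`, and `C_s` has no zero on it. -/
def regionQ (s : ℕ) : Set ℂ :=
  {q | ‖(q - 1) ^ s - (-1) ^ s‖ < ‖(q - 1) ^ s + (q - 1) * (-1) ^ s‖}

/-! Each edge ab of G is replaced by p paths of length s from a to a new vertex m, followed by a
single edge mb. With n colours, let C and D be the numbers of proper colourings of the interior of
one path when its two ends have equal, respectively different, colours. Where |D| < |C|, many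
parallel paths force m to take the colour of a in the limit, and the edge mb then forces a and b to
differ.

Precisely, summing out the interiors and then the colour of m leaves a sum over colourings of V(G)
in which an edge has weight (n-1)D^p if its ends agree and C^p + (n-2)D^p otherwise
(`eval_chromaticPolynomial_inflate`). The Fortuin-Kasteleyn expansion `sum_prod_ite_eq` makes this
an identity of polynomials (`chromaticPolynomial_inflate`), so n may be replaced by a complex q.
Then C becomes C_s(q), and Q_s is the region |D| < |C|. After division by C^p, once per edge, the
weights tend to 0 and 1, which are those of P_G; hence k = |E(G)|. Complex zeros follow by Hurwitz's
theorem, real ones from a sign change.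

The combinatorial claims are local to an edge. For surfaces, the drawing of G is first made radial
in small disjoint discs around the vertices (`exists_discDrawing`); then m and all p paths fit into
a thin sector beside the first radius of the edge, while mb follows the rest of the old edge. -/

namespace Graph

/-! ### Potts sums, colourings and the chromatic polynomial -/

variable {α : Type u} {β : Type v}

/-- Vertex colourings which are constant along the edges of `A` are the same as colourings of the
connected components of `(V, A)`. -/
noncomputable def constOnEquiv (G : Graph α β) (A : Set β) (κ : Type*) :
    {c : V(G) → κ // ∀ e ∈ A, ∀ x y : V(G), G.IsLink e x y → c x = c y} ≃
      ((G.restrict A).toSimpleGraph.ConnectedComponent → κ) where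
  toFun c := fun K ↦ K.lift c.1 (by
    intro x y w hw
    clear hw
    induction w with
    | nil => rfl
    | cons h w ih =>
      obtain ⟨-, e, he⟩ := h
      exact (c.2 e he.1 _ _ he.2).trans ih)
  invFun f := ⟨fun x ↦ f ((G.restrict A).toSimpleGraph.connectedComponentMk x), by
    intro e he x y hxy
    by_cases h : x = y
    · rw [h]
    · have : (G.restrict A).toSimpleGraph.Adj x y := ⟨h, e, he, hxy⟩
      exact congrArg f (SimpleGraph.ConnectedComponent.sound this.reachable)⟩
  left_inv c := rfl
  right_inv f := by
    ext K
    induction K using SimpleGraph.ConnectedComponent.ind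
    rfl

/-- The Fortuin-Kasteleyn expansion of a Potts sum with the same weight on all edges. -/
theorem sum_prod_ite_eq (G : Graph α β) {ι : Type*} {ε : Type*} [Fintype ι] [DecidableEq ι]
    [Fintype ε] (fv : ι ≃ V(G)) (fe : ε ≃ E(G)) (a b : ε → ι)
    (hab : ∀ e, G.IsLink (fe e) (fv (a e)) (fv (b e))) {R : Type*} [CommRing R] (z w : R) (n : ℕ) :
    ∑ c : ι → Fin n, ∏ e, (if c (a e) = c (b e) then w + z else z) =
      ∑ A : Finset ε, z ^ (Fintype.card ε - A.card) * w ^ A.card *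
        (n : R) ^ G.numComponents ((fun e ↦ (fe e : β)) '' (A : Set ε)) := by
  classical
  have h1 (c : ι → Fin n) : ∏ e, (if c (a e) = c (b e) then w + z else z) =
      ∑ A : Finset ε, z ^ (Fintype.card ε - A.card) * w ^ A.card *
        (if ∀ e ∈ A, c (a e) = c (b e) then 1 else 0) := by
    -- Each factor is z plus a term w present only when the ends agree; expanding the product
    -- selects the set A of edges contributing w.
    have : ∀ e, (if c (a e) = c (b e) then w + z else z) =
        (if c (a e) = c (b e) then w else 0) + z := by intro e; split_ifs <;> simp
    simp_rw [this]
    rw [Finset.prod_add, Finset.powerset_univ]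
    refine Finset.sum_congr rfl fun A _ ↦ ?_
    rw [Finset.prod_const, ← Finset.compl_eq_univ_sdiff, Finset.card_compl]
    split_ifs with h
    · rw [Finset.prod_congr rfl fun e he ↦ if_pos (h e he), Finset.prod_const]; ring
    · push Not at h
      obtain ⟨e, he, hne⟩ := h
      rw [Finset.prod_eq_zero he (by simp [hne])]; simp
  simp_rw [h1]
  rw [Finset.sum_comm]
  refine Finset.sum_congr rfl fun A _ ↦ ?_
  rw [← Finset.mul_sum, Finset.sum_boole]
  congr 1
  rw [← Nat.cast_pow]
  congr 1
  have : Finite V(G) := Finite.of_equiv _ fv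
  have : Fintype V(G) := Fintype.ofFinite _
  rw [numComponents]
  set A' : Set β := (fun e ↦ (fe e : β)) '' (A : Set ε)
  -- The colourings that survive for A are constant on components of (V, A), so there are n^k(A) of
  -- them.
  have e1 : {c : ι → Fin n // ∀ e ∈ A, c (a e) = c (b e)} ≃
      {c : V(G) → Fin n // ∀ e ∈ A', ∀ x y : V(G), G.IsLink e x y → c x = c y} := by
    refine (Equiv.arrowCongr fv (Equiv.refl _)).subtypeEquiv fun c ↦ ?_
    constructor
    · rintro h _ ⟨e, he, rfl⟩ x y hxy
      have := h e he
      rcases (hab e).eq_and_eq_or_eq_and_eq hxy with ⟨h1, h2⟩ | ⟨h1, h2⟩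
      · simp [← Subtype.ext h1, ← Subtype.ext h2, this]
      · simp [← Subtype.ext h1, ← Subtype.ext h2, this]
    · intro h e he
      simpa using h _ ⟨e, he, rfl⟩ _ _ (hab e)
  have hc : Finite (G.restrict A').toSimpleGraph.ConnectedComponent :=
    Quot.finite (α := V(G)) _
  have := Nat.card_congr (e1.trans (constOnEquiv G A' (Fin n)))
  rw [Nat.card_fun, Nat.card_fin, Nat.card_eq_fintype_card, Fintype.card_subtype] at this
  exact this

theorem chromaticPolynomial_eq_sum (G : Graph α β) {ε : Type*} [Fintype ε] (fe : ε ≃ E(G)) :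
    G.chromaticPolynomial = ∑ A : Finset ε,
      (-1) ^ A.card * Polynomial.X ^ G.numComponents ((fun e ↦ (fe e : β)) '' (A : Set ε)) := by
  classical
  rw [chromaticPolynomial, ← finsum_eq_sum_of_fintype]
  rw [← finsum_mem_univ (fun A : Finset ε ↦ (-1 : Polynomial ℤ) ^ A.card *
    Polynomial.X ^ G.numComponents ((fun e ↦ (fe e : β)) '' (A : Set ε)))]
  symm
  refine finsum_mem_eq_of_bijOn (fun A : Finset ε ↦ (fun e ↦ (fe e : β)) '' (A : Set ε)) ?_ ?_
  · have hinj : Function.Injective (fun e ↦ (fe e : β)) :=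
      Subtype.val_injective.comp fe.injective
    refine ⟨?_, ?_, ?_⟩
    · rintro A - _ ⟨e, -, rfl⟩
      exact (fe e).2
    · intro A _ B _ h
      exact Finset.coe_injective (hinj.image_injective h)
    · intro B hB
      refine ⟨Finset.univ.filter fun e ↦ (fe e : β) ∈ B, trivial, ?_⟩
      ext x
      constructor
      · rintro ⟨e, he, rfl⟩
        simpa using he
      · intro hx
        exact ⟨fe.symm ⟨x, hB hx⟩, by simpa using hx, by simp⟩
  · intro A _
    have hinj : Function.Injective (fun e ↦ (fe e : β)) :=
      Subtype.val_injective.comp fe.injective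
    rw [Set.ncard_image_of_injective _ hinj, Set.ncard_coe_finset]

/-- At a natural number `n`, the chromatic polynomial counts the proper `n`-colourings. -/
theorem eval_chromaticPolynomial (G : Graph α β) {ι : Type*} {ε : Type*} [Fintype ι] [DecidableEq ι]
    [Fintype ε] (fv : ι ≃ V(G)) (fe : ε ≃ E(G)) (a b : ε → ι)
    (hab : ∀ e, G.IsLink (fe e) (fv (a e)) (fv (b e))) (n : ℕ) :
    G.chromaticPolynomial.eval (n : ℤ) =
      ∑ c : ι → Fin n, ∏ e, (if c (a e) = c (b e) then 0 else 1) := by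
  classical
  have := G.sum_prod_ite_eq fv fe a b hab (1 : ℤ) (-1) n
  simp only [neg_add_cancel, one_pow, one_mul] at this
  rw [this, G.chromaticPolynomial_eq_sum fe, Polynomial.eval_finsetSum]
  simp

/-- With |V| colours, giving every vertex its own colour is proper because there are no loops, so
the value at |V| is positive. Nonvanishing makes the zeros isolated, as Hurwitz's theorem requires.
-/
theorem chromaticPolynomial_ne_zero (G : Graph α β) (hV : V(G).Finite) (hE : E(G).Finite)
    (hG : G.Loopless) : G.chromaticPolynomial ≠ 0 := by
  classical
  have := hV.fintype
  have := hE.fintype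
  choose a b hab using fun e : E(G) ↦ G.exists_isLink_of_mem_edgeSet e.2
  intro h0
  have h := G.eval_chromaticPolynomial (Equiv.refl _) (Equiv.refl _)
    (fun e ↦ ⟨a e, (hab e).left_mem⟩) (fun e ↦ ⟨b e, (hab e).right_mem⟩) hab
    (Fintype.card V(G))
  rw [h0, Polynomial.eval_zero] at h
  refine (Finset.sum_pos' (fun c _ ↦ Finset.prod_nonneg fun e _ ↦ ?_)
    ⟨(Fintype.equivFin V(G) : V(G) → _), Finset.mem_univ _, Finset.prod_pos fun e _ ↦ ?_⟩).ne h
  · split_ifs <;> simp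
  · rw [if_neg]
    · exact one_pos
    · intro heq
      have hl := hab e
      rw [show a e = b e from Subtype.ext_iff.1 ((Fintype.equivFin V(G)).injective heq)] at hl
      exact hG.not_isLoopAt _ _ hl

end Graph

/-! ### The inflated graph: colourings, degeneracy, connectedness -/

namespace Graph

/-- The graph with prescribed vertices, edges and ends. -/
def ofEnds {α : Type u} {β : Type v} (V : Set α) (E : Set β) (fst snd : β → α)
    (h : ∀ e ∈ E, fst e ∈ V ∧ snd e ∈ V) : Graph α β where
  vertexSet := V
  edgeSet := E
  IsLink e x y := e ∈ E ∧ ((x = fst e ∧ y = snd e) ∨ (x = snd e ∧ y = fst e))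
  isLink_symm e _ := ⟨fun x y ⟨he, hxy⟩ ↦ ⟨he, by tauto⟩⟩
  eq_or_eq_of_isLink_of_isLink e x y v w h1 h2 := by
    obtain ⟨-, ⟨rfl, rfl⟩ | ⟨rfl, rfl⟩⟩ := h1 <;> obtain ⟨-, ⟨rfl, rfl⟩ | ⟨rfl, rfl⟩⟩ := h2 <;> simp
  edge_mem_iff_exists_isLink e := ⟨fun he ↦ ⟨_, _, he, .inl ⟨rfl, rfl⟩⟩, fun ⟨_, _, he, _⟩ ↦ he⟩
  left_mem_of_isLink e x y := by
    rintro ⟨he, ⟨rfl, -⟩ | ⟨rfl, -⟩⟩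
    exacts [(h e he).1, (h e he).2]

theorem Colorable.of_ne {α : Type u} {β : Type v} {G : Graph α β} {n : ℕ} (c : α → Fin n)
    (h : ∀ e x y, G.IsLink e x y → c x ≠ c y) : G.Colorable n :=
  ⟨fun x ↦ c x, fun x y ⟨e, he⟩ ↦ h e x y he⟩

theorem degree_le_two {α : Type u} {β : Type v} {G : Graph α β} (hG : G.Loopless) {x : α} (f g : β)
    (h : ∀ e y, G.IsLink e x y → e = f ∨ e = g) : G.degree x ≤ 2 := by
  have h1 : {e | G.IsLoopAt e x} = ∅ :=
    Set.eq_empty_of_forall_notMem fun e he ↦ hG.not_isLoopAt _ _ he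
  rw [degree, h1, Set.encard_empty, mul_zero, add_zero]
  refine (Set.encard_le_encard (t := {f, g}) ?_).trans
    ((Set.encard_insert_le _ _).trans (by rw [Set.encard_singleton]; rfl))
  rintro e ⟨y, -, hy⟩
  exact h e y hy

theorem IsDegenerate.of_forall_exists {α : Type u} {β : Type v} {G : Graph α β} {k : ℕ}
    (h : ∀ H ≤ G, V(H).Nonempty → ∃ x ∈ V(H), H.degree x ≤ k) : G.IsDegenerate k := by
  refine iSup_le fun H ↦ iSup_le fun hH ↦ iSup_le fun hne ↦ ?_
  obtain ⟨x, hx, hd⟩ := h H hH hne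
  exact (iInf₂_le x hx).trans hd

/-- Vertices of the inflation of a graph with vertices `ι` and edges `ε`. -/
inductive InflVertex (ι : Type u) (ε : Type v) : Type (max u v)
  | orig (x : ι)
  | mid (e : ε)
  -- The indices are unbounded so that one type serves all p and s; the bounds are imposed by the
  -- vertex set.
  | onPath (e : ε) (j i : ℕ)

/-- Edges of the inflation of a graph with vertices `ι` and edges `ε`. -/
inductive InflEdge (ι : Type u) (ε : Type v) : Type (max u v)
  | link (e : ε)
  | seg (e : ε) (j i : ℕ)

open InflVertex InflEdge

section

variable {ι : Type u} {ε : Type v} (a b : ε → ι) (s p : ℕ)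

/-- The `i`-th vertex on the `j`-th path of length `s` from `a e` to the midpoint of `e`. -/
def pathNode (e : ε) (j i : ℕ) : InflVertex ι ε :=
  if i = 0 then orig (a e) else if i = s then mid e else onPath e j i

/-- First end of an edge of the inflation. -/
def inflFst : InflEdge ι ε → InflVertex ι ε
  | link e => mid e
  | seg e j i => pathNode a s e j i

/-- Second end of an edge of the inflation. -/
def inflSnd : InflEdge ι ε → InflVertex ι ε
  | link e => orig (b e)
  | seg e j i => pathNode a s e j (i + 1)

/-- The vertex set of the inflation. -/
def inflVertexSet (ι : Type u) (ε : Type v) (s p : ℕ) : Set (InflVertex ι ε)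
  | orig _ => True
  | mid _ => True
  | onPath _ j i => j < p ∧ 0 < i ∧ i < s

/-- The edge set of the inflation. -/
def inflEdgeSet (ι : Type u) (ε : Type v) (s p : ℕ) : Set (InflEdge ι ε)
  | link _ => True
  | seg _ j i => j < p ∧ i < s

@[simp] theorem orig_mem (x : ι) : (orig x : InflVertex ι ε) ∈ inflVertexSet ι ε s p := trivial

@[simp] theorem mid_mem (e : ε) : (mid e : InflVertex ι ε) ∈ inflVertexSet ι ε s p := trivial

@[simp] theorem onPath_mem (e : ε) (j i : ℕ) :
    (onPath e j i : InflVertex ι ε) ∈ inflVertexSet ι ε s p ↔ j < p ∧ 0 < i ∧ i < s := Iff.rfl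

@[simp] theorem seg_mem (e : ε) (j i : ℕ) :
    (seg e j i : InflEdge ι ε) ∈ inflEdgeSet ι ε s p ↔ j < p ∧ i < s := Iff.rfl

theorem pathNode_mem {e : ε} {j i : ℕ} (hj : j < p) (hi : i ≤ s) :
    pathNode a s e j i ∈ inflVertexSet ι ε s p := by
  unfold pathNode
  split_ifs
  · simp
  · simp
  · simp; omega

/-- The inflation of the graph with ends `a e`, `b e`: every edge `e` is replaced by `p` paths of
length `s` from `a e` to a new vertex `mid e`, followed by an edge from `mid e` to `b e`. -/
def inflate : Graph (InflVertex ι ε) (InflEdge ι ε) :=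
  ofEnds (inflVertexSet ι ε s p) (inflEdgeSet ι ε s p) (inflFst a s) (inflSnd a b s) (by
    rintro (e | ⟨e, j, i⟩) he
    · simp [inflFst, inflSnd]
    · simp only [seg_mem] at he
      exact ⟨pathNode_mem a s p he.1 he.2.le, pathNode_mem a s p he.1 he.2⟩)

theorem inflate_isLink {f : InflEdge ι ε} {x y : InflVertex ι ε} :
    (inflate a b s p).IsLink f x y ↔ f ∈ inflEdgeSet ι ε s p ∧
      ((x = inflFst a s f ∧ y = inflSnd a b s f) ∨ (x = inflSnd a b s f ∧ y = inflFst a s f)) :=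
  Iff.rfl

variable {a b s p}

theorem inflate_colorable_of_ne {n : ℕ} (c : InflVertex ι ε → Fin n)
    (h1 : ∀ e, c (mid e) ≠ c (orig (b e)))
    (h2 : ∀ e, ∀ j < p, ∀ i < s, c (pathNode a s e j i) ≠ c (pathNode a s e j (i + 1))) :
    (inflate a b s p).Colorable n := by
  have key : ∀ f ∈ inflEdgeSet ι ε s p, c (inflFst a s f) ≠ c (inflSnd a b s f) := by
    rintro (e | ⟨e, j, i⟩) hf
    · exact h1 e
    · exact h2 e j hf.1 i hf.2
  refine Colorable.of_ne c ?_
  rintro f x y ⟨hf, ⟨rfl, rfl⟩ | ⟨rfl, rfl⟩⟩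
  · exact key f hf
  · exact (key f hf).symm

theorem inflate_colorable_three (hs : 2 ≤ s) : (inflate a b s p).Colorable 3 := by
  -- Paths alternate 0, 1 from an original vertex; colour 2 on the last interior vertex absorbs the
  -- parity of s.
  refine inflate_colorable_of_ne (fun v ↦ match v with
    | orig _ => 0
    | mid _ => 1
    | onPath _ _ i => if i + 1 = s then 2 else if Even i then 0 else 1) ?_ ?_
  · simp
  · intro e j _ i hi
    simp only [pathNode]
    have : Even (i + 1) ↔ ¬ Even i := Nat.even_add_one
    grind

theorem inflate_isBipartite (hs : Even s) (c : ι → Fin 2) (hc : ∀ e, c (a e) ≠ c (b e)) :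
    (inflate a b s p).IsBipartite := by
  -- For even s an alternating path returns to the colour of `a e`, so the last edge is coloured
  -- like the original edge `e`.
  refine inflate_colorable_of_ne (fun v ↦ match v with
    | orig x => c x
    | mid e => c (a e)
    | onPath e _ i => if Even i then c (a e) else (c (a e)).rev) ?_ ?_
  · exact hc
  · intro e j _ i hi
    have h (z : Fin 2) : z.rev ≠ z := by decide +revert
    have : Even (i + 1) ↔ ¬ Even i := Nat.even_add_one
    simp only [pathNode]
    grind

theorem pathNode_ne_succ (hs : 2 ≤ s) (e : ε) (j i : ℕ) :
    pathNode a s e j i ≠ pathNode a s e j (i + 1) := by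
  unfold pathNode
  grind

theorem inflate_loopless (hs : 2 ≤ s) : (inflate a b s p).Loopless := by
  refine ⟨?_⟩
  rintro (e | ⟨e, j, i⟩) x ⟨-, ⟨h1, h2⟩ | ⟨h1, h2⟩⟩
  · simp [h1, inflFst, inflSnd] at h2
  · simp [h1, inflFst, inflSnd] at h2
  · exact pathNode_ne_succ hs e j i (h1.symm.trans h2)
  · exact pathNode_ne_succ hs e j i (h2.symm.trans h1)

/-- Interior path vertices have degree at most 2. In a subgraph without them a midpoint keeps only
its edge to `b e`, since paths of length at least 2 have no edge joining `a e` directly to it.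
Without midpoints as well, the original vertices are isolated. -/
theorem inflate_isDegenerate (hs : 2 ≤ s) : (inflate a b s p).IsDegenerate 2 := by
  refine .of_forall_exists fun H hH ⟨x₀, hx₀⟩ ↦ ?_
  have : (inflate a b s p).Loopless := inflate_loopless hs
  have hl : H.Loopless := Loopless.anti hH
  by_cases h1 : ∃ e j i, onPath e j i ∈ V(H)
  · obtain ⟨e, j, i, h⟩ := h1
    have hi : onPath e j i ∈ inflVertexSet ι ε s p := hH.vertexSet_mono h
    refine ⟨_, h, degree_le_two hl (seg e j i) (seg e j (i - 1)) ?_⟩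
    intro f y hf
    obtain ⟨hf, h⟩ := (inflate_isLink ..).1 (hf.mono hH)
    obtain e' | ⟨e', j', i'⟩ := f
    · simp [inflFst, inflSnd] at h
    · simp only [inflFst, inflSnd, pathNode] at h
      grind
  · push Not at h1
    by_cases h2 : ∃ e, mid e ∈ V(H)
    · obtain ⟨e, h⟩ := h2
      refine ⟨_, h, degree_le_two hl (link e) (link e) ?_⟩
      intro f y hf
      have hy := hf.right_mem
      obtain ⟨hf, h⟩ := (inflate_isLink ..).1 (hf.mono hH)
      obtain e' | ⟨e', j', i'⟩ := f
      · simp [inflFst, inflSnd] at h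
        simp [h.1]
      · simp only [inflFst, inflSnd, pathNode, seg_mem] at h hf
        grind
    · push Not at h2
      obtain x | e | ⟨e, j, i⟩ := x₀
      · by_cases hε : ∃ f y, H.IsLink f (orig x) y
        · obtain ⟨f, y, hf⟩ := hε
          exfalso
          have hy := hf.right_mem
          obtain ⟨hf, h⟩ := (inflate_isLink ..).1 (hf.mono hH)
          obtain e' | ⟨e', j', i'⟩ := f
          · simp [inflFst, inflSnd] at h
            exact h2 _ (h.2 ▸ hy)
          · simp only [inflFst, inflSnd, pathNode, seg_mem] at h hf
            grind
        · refine ⟨_, hx₀, ?_⟩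
          push Not at hε
          rw [degree, Set.eq_empty_of_forall_notMem (s := {e | H.IsNonloopAt e _}),
            Set.eq_empty_of_forall_notMem (s := {e | H.IsLoopAt e _})]
          · simp
          · exact fun f hf ↦ hε _ _ hf
          · exact fun f ⟨y, _, hf⟩ ↦ hε _ _ hf
      · exact absurd hx₀ (h2 e)
      · exact absurd hx₀ (h1 e j i)

theorem inflate_isConnected (hs : 2 ≤ s) (hp : 1 ≤ p) [Nonempty ι]
    (h : ∀ x y : ι, Relation.EqvGen (fun x y ↦ ∃ e, x = a e ∧ y = b e) x y) :
    (inflate a b s p).IsConnected := by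
  have := inflate_loopless (a := a) (b := b) (p := p) hs
  set Γ := (inflate a b s p).toSimpleGraph
  have hadj {f x y} (hf : (inflate a b s p).IsLink f x y) (hx) (hy) :
      Γ.Reachable ⟨x, hx⟩ ⟨y, hy⟩ :=
    SimpleGraph.Adj.reachable ((toSimpleGraph_adj_iff ⟨x, hx⟩ ⟨y, hy⟩).2 ⟨f, hf⟩)
  have hpath (e : ε) {j : ℕ} (hj : j < p) : ∀ i (hi : i ≤ s),
      Γ.Reachable ⟨orig (a e), trivial⟩ ⟨pathNode a s e j i, pathNode_mem a s p hj hi⟩ := by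
    intro i
    induction i with
    | zero => exact fun _ ↦ .rfl
    | succ i ih =>
      intro hi
      refine (ih (by omega)).trans (hadj (f := seg e j i) ?_ _ _)
      exact (inflate_isLink ..).2 ⟨⟨hj, hi⟩, .inl ⟨rfl, rfl⟩⟩
  have hmid (e : ε) : Γ.Reachable ⟨orig (a e), trivial⟩ ⟨mid e, trivial⟩ := by
    convert hpath e (j := 0) (by omega) s le_rfl using 2
    simp [pathNode, show s ≠ 0 by omega]
  have hedge (e : ε) : Γ.Reachable ⟨orig (a e), trivial⟩ ⟨orig (b e), trivial⟩ := by
    refine (hmid e).trans (hadj (f := link e) ?_ _ _)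
    exact (inflate_isLink ..).2 ⟨trivial, .inl ⟨rfl, rfl⟩⟩
  have horig (x y : ι) : Γ.Reachable ⟨orig x, trivial⟩ ⟨orig y, trivial⟩ := by
    induction h x y with
    | rel x y h => obtain ⟨e, rfl, rfl⟩ := h; exact hedge e
    | refl x => rfl
    | symm x y _ ih => exact ih.symm
    | trans x y z _ _ ih1 ih2 => exact ih1.trans ih2
  have hall (v : V(inflate a b s p)) : ∃ x, Γ.Reachable ⟨orig x, trivial⟩ v := by
    obtain ⟨x | e | ⟨e, j, i⟩, hv⟩ := v
    · exact ⟨x, .rfl⟩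
    · exact ⟨_, hmid e⟩
    · refine ⟨a e, ?_⟩
      have hv' : j < p ∧ 0 < i ∧ i < s := hv
      convert hpath e hv'.1 i hv'.2.2.le using 2
      simp [pathNode, hv'.2.1.ne', hv'.2.2.ne]
  refine (SimpleGraph.connected_iff_exists_forall_reachable _).2
    ⟨⟨orig (Classical.arbitrary ι), trivial⟩, fun v ↦ ?_⟩
  obtain ⟨x, hx⟩ := hall v
  exact (horig _ x).trans hx

/-- The vertices of the inflation, sorted by kind. -/
def inflVertexEquiv (a b : ε → ι) (s p : ℕ) :
    ι ⊕ ε ⊕ (ε × Fin p) × Fin s ≃ V(inflate a b (s + 1) p) where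
  toFun
    | .inl x => ⟨orig x, trivial⟩
    | .inr (.inl e) => ⟨mid e, trivial⟩
    -- A path of length s + 1 has s interior vertices, numbered from 1.
    | .inr (.inr ((e, j), i)) => ⟨onPath e j (i + 1), j.2, Nat.succ_pos _, Nat.succ_lt_succ i.2⟩
  invFun
    | ⟨orig x, _⟩ => .inl x
    | ⟨mid e, _⟩ => .inr (.inl e)
    | ⟨onPath e j i, h⟩ => .inr (.inr ((e, ⟨j, h.1⟩),
        ⟨i - 1, by have h : j < p ∧ 0 < i ∧ i < s + 1 := h; omega⟩))
  left_inv := by rintro (x | e | ⟨⟨e, j⟩, i⟩) <;> rfl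
  right_inv := by
    rintro ⟨x | e | ⟨e, j, i⟩, h⟩
    · rfl
    · rfl
    · have h' : j < p ∧ 0 < i ∧ i < s + 1 := h
      simp [Nat.sub_add_cancel h'.2.1]

/-- The edges of the inflation, sorted by kind. -/
def inflEdgeEquiv (a b : ε → ι) (s p : ℕ) :
    ε ⊕ (ε × Fin p) × Fin s ≃ E(inflate a b s p) where
  toFun
    | .inl e => ⟨link e, trivial⟩
    | .inr ((e, j), i) => ⟨seg e j i, j.2, i.2⟩
  invFun
    | ⟨link e, _⟩ => .inl e
    | ⟨seg e j i, h⟩ => .inr ((e, ⟨j, h.1⟩), ⟨i, h.2⟩)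
  left_inv := by rintro (e | ⟨⟨e, j⟩, i⟩) <;> rfl
  right_inv := by rintro ⟨e | ⟨e, j, i⟩, h⟩ <;> rfl

end

end Graph

/-! ### Walk counts in complete graphs and the chromatic polynomial of the inflation -/

open Polynomial in
/-- The polynomials counting, for `K_n`, the walks of a given length from a vertex to itself and
from a vertex to another given vertex. -/
noncomputable def walkPolynomials : ℕ → ℤ[X] × ℤ[X]
  | 0 => (1, 0)
  | s + 1 => ((X - 1) * (walkPolynomials s).2,
      (walkPolynomials s).1 + (X - 2) * (walkPolynomials s).2)

/-- The polynomial counting the closed walks of length `s` at a vertex of `K_n`. -/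
noncomputable def closedWalkPoly (s : ℕ) : Polynomial ℤ := (walkPolynomials s).1

/-- The polynomial counting the walks of length `s` in `K_n` between two different vertices. -/
noncomputable def openWalkPoly (s : ℕ) : Polynomial ℤ := (walkPolynomials s).2

-- These are the spectral formulas for K_n, whose adjacency matrix has eigenvalues n - 1 and -1. The
-- factor X avoids a division, so that both counts remain integer polynomials.
open Polynomial in
theorem X_mul_walkPolynomials (s : ℕ) :
    X * closedWalkPoly s = (X - 1) ^ s + (X - 1) * (-1) ^ s ∧
      X * openWalkPoly s = (X - 1) ^ s - (-1) ^ s := by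
  induction s with
  | zero => simp [closedWalkPoly, openWalkPoly, walkPolynomials]
  | succ s ih =>
    simp only [closedWalkPoly, openWalkPoly, walkPolynomials] at ih ⊢
    constructor
    · linear_combination (X - 1) * ih.2
    · linear_combination ih.1 + (X - 2) * ih.2

/-- This sums out the colour of one vertex that must differ from x and carries a weight depending on
whether it equals y. It serves both for one step along a path and for the midpoint of an inflated
edge. -/
theorem sum_ite_ite {κ R : Type*} [Fintype κ] [DecidableEq κ] [CommRing R] (x y : κ) (C D : R) :
    ∑ c, (if c = x then 0 else 1) * (if c = y then C else D) =
      if x = y then (Fintype.card κ - 1) * D else C + (Fintype.card κ - 2) * D := by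
  have h (c : κ) : (if c = x then 0 else 1) * (if c = y then C else D) =
      D + (if c = y then C - D else 0) - (if c = x then (if x = y then C else D) else 0) := by
    split_ifs <;> simp_all
  simp_rw [h, Finset.sum_sub_distrib, Finset.sum_add_distrib, Finset.sum_ite_eq' Finset.univ]
  simp only [Finset.mem_univ, if_true, Finset.sum_const, Finset.card_univ, nsmul_eq_mul]
  split_ifs <;> ring

theorem prod_comp_fst {κ R : Type*} [Fintype κ] [CommMonoid R] (h : κ → R) (p : ℕ) :
    ∏ x : κ × Fin p, h x.1 = ∏ e, h e ^ p := by
  rw [Fintype.prod_prod_type]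
  simp

-- The word `w` colours the interior; the edges have left ends x, w and right ends w, y. Splitting
-- off the first interior colour reproduces the recursion of `walkPolynomials`.
open Polynomial in
theorem sum_path_colorings {n : ℕ} (s : ℕ) (x y : Fin n) :
    ∑ w : Fin s → Fin n, ∏ i : Fin (s + 1),
      (if (Fin.cons x w : Fin (s + 1) → Fin n) i = (Fin.snoc w y : Fin (s + 1) → Fin n) i
        then (0 : ℤ) else 1) =
      if x = y then (closedWalkPoly (s + 1)).eval (n : ℤ)
        else (openWalkPoly (s + 1)).eval (n : ℤ) := by
  induction s generalizing x with
  | zero => simp [closedWalkPoly, openWalkPoly, walkPolynomials, Fin.snoc]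
  | succ s ih =>
    rw [← (Fin.consEquiv fun _ : Fin (s + 1) ↦ Fin n).sum_comp, Fintype.sum_prod_type]
    change ∑ c, ∑ w : Fin s → Fin n, ∏ i : Fin (s + 1 + 1),
      (if (Fin.cons x (Fin.cons c w : Fin (s + 1) → Fin n) : Fin (s + 1 + 1) → Fin n) i =
        (Fin.snoc (Fin.cons c w : Fin (s + 1) → Fin n) y : Fin (s + 1 + 1) → Fin n) i
        then (0 : ℤ) else 1) = _
    have hsnoc (c : Fin n) (w : Fin s → Fin n) :
        (Fin.snoc (Fin.cons c w : Fin (s + 1) → Fin n) y : Fin (s + 1 + 1) → Fin n) =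
          Fin.cons c (Fin.snoc w y : Fin (s + 1) → Fin n) :=
      (Fin.cons_snoc_eq_snoc_cons c w y).symm
    simp only [hsnoc, Fin.prod_univ_succ (n := s + 1), Fin.cons_zero, Fin.cons_succ,
      ← Finset.mul_sum, ih]
    simp_rw [eq_comm (a := x)]
    rw [sum_ite_ite, Fintype.card_fin]
    simp only [eq_comm (b := x)]
    simp [closedWalkPoly, openWalkPoly, walkPolynomials]

namespace Graph

open InflVertex InflEdge

variable {α : Type u} {β : Type v} {ι : Type u} {ε : Type v} [Fintype ι] [DecidableEq ι]
  [Fintype ε] (a b : ε → ι)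

/-- Once the original vertices and the midpoints are coloured, the paths are independent of each
other; once the original vertices are coloured, so are the midpoints. Both inner sums therefore
factor. -/
theorem eval_chromaticPolynomial_inflate (s p n : ℕ) :
    (inflate a b (s + 1) p).chromaticPolynomial.eval (n : ℤ) =
      ∑ σ : ι → Fin n, ∏ e, if σ (a e) = σ (b e)
        then (n - 1) * (openWalkPoly (s + 1)).eval (n : ℤ) ^ p
        else (closedWalkPoly (s + 1)).eval (n : ℤ) ^ p +
          (n - 2) * (openWalkPoly (s + 1)).eval (n : ℤ) ^ p := by
  classical
  rw [eval_chromaticPolynomial _ (inflVertexEquiv a b s p) (inflEdgeEquiv a b (s + 1) p)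
    (Sum.elim (fun e ↦ .inr (.inl e)) fun x ↦
      (Fin.cons (.inl (a x.1.1)) fun i ↦ .inr (.inr (x.1, i)) :
        Fin (s + 1) → ι ⊕ ε ⊕ (ε × Fin p) × Fin s) x.2)
    (Sum.elim (fun e ↦ .inl (b e)) fun x ↦
      (Fin.snoc (fun i ↦ .inr (.inr (x.1, i))) (.inr (.inl x.1.1)) :
        Fin (s + 1) → ι ⊕ ε ⊕ (ε × Fin p) × Fin s) x.2)]
  · have hcons (c : ι ⊕ ε ⊕ (ε × Fin p) × Fin s → Fin n) (u : _) (f : Fin s → _)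
        (i : Fin (s + 1)) : c ((Fin.cons u f : Fin (s + 1) → _) i) =
          (Fin.cons (c u) (c ∘ f) : Fin (s + 1) → Fin n) i := by
      refine Fin.cases ?_ (fun i ↦ ?_) i <;> simp
    have hsnoc (c : ι ⊕ ε ⊕ (ε × Fin p) × Fin s → Fin n) (u : _) (f : Fin s → _)
        (i : Fin (s + 1)) : c ((Fin.snoc f u : Fin (s + 1) → _) i) =
          (Fin.snoc (c ∘ f) (c u) : Fin (s + 1) → Fin n) i := by
      refine Fin.lastCases ?_ (fun i ↦ ?_) i <;> simp
    simp only [Fintype.prod_sum_type, Sum.elim_inl, Sum.elim_inr, hcons, hsnoc]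
    rw [← (Equiv.sumArrowEquivProdArrow _ _ _).symm.sum_comp, Fintype.sum_prod_type]
    refine Finset.sum_congr rfl fun σ _ ↦ ?_
    rw [← (Equiv.sumArrowEquivProdArrow _ _ _).symm.sum_comp, Fintype.sum_prod_type]
    -- With midpoint colours `μ` fixed, the sum over all path interiors is a product over pairs of
    -- an edge and a path index.
    have hw (μ : ε → Fin n) :
        ∑ w : (ε × Fin p) × Fin s → Fin n, ∏ x : (ε × Fin p) × Fin (s + 1),
          (if (Fin.cons (σ (a x.1.1)) fun i ↦ w (x.1, i) : Fin (s + 1) → Fin n) x.2 =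
            (Fin.snoc (fun i ↦ w (x.1, i)) (μ x.1.1) : Fin (s + 1) → Fin n) x.2
            then (0 : ℤ) else 1) =
        ∏ e, (if μ e = σ (a e) then (closedWalkPoly (s + 1)).eval (n : ℤ)
          else (openWalkPoly (s + 1)).eval (n : ℤ)) ^ p := by
      rw [← (Equiv.curry _ _ _).symm.sum_comp]
      let g (x : ε × Fin p) (v : Fin s → Fin n) : ℤ := ∏ i : Fin (s + 1),
        (if (Fin.cons (σ (a x.1)) v : Fin (s + 1) → Fin n) i =
          (Fin.snoc v (μ x.1) : Fin (s + 1) → Fin n) i then (0 : ℤ) else 1)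
      calc _ = ∑ w : ε × Fin p → Fin s → Fin n, ∏ x, g x (w x) :=
            Finset.sum_congr rfl fun w _ ↦ Fintype.prod_prod_type _
        _ = ∏ x, ∑ v, g x v := by rw [Finset.prod_univ_sum, Fintype.piFinset_univ]
        _ = ∏ x : ε × Fin p, (if μ x.1 = σ (a x.1) then (closedWalkPoly (s + 1)).eval (n : ℤ)
              else (openWalkPoly (s + 1)).eval (n : ℤ)) :=
            Finset.prod_congr rfl fun x _ ↦ by
              simp only [g, sum_path_colorings, eq_comm (a := μ x.1)]
        _ = _ := prod_comp_fst (fun e ↦ if μ e = σ (a e) then (closedWalkPoly (s + 1)).eval (n : ℤ)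
              else (openWalkPoly (s + 1)).eval (n : ℤ)) p
    calc _ = ∑ μ : ε → Fin n, (∏ e, if μ e = σ (b e) then (0 : ℤ) else 1) *
          ∏ e, (if μ e = σ (a e) then (closedWalkPoly (s + 1)).eval (n : ℤ)
            else (openWalkPoly (s + 1)).eval (n : ℤ)) ^ p := by
          refine Finset.sum_congr rfl fun μ _ ↦ ?_
          rw [← hw, Finset.mul_sum]
          rfl
      _ = ∑ μ : ε → Fin n, ∏ e, (if μ e = σ (b e) then (0 : ℤ) else 1) *
            (if μ e = σ (a e) then (closedWalkPoly (s + 1)).eval (n : ℤ) ^ p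
              else (openWalkPoly (s + 1)).eval (n : ℤ) ^ p) := by
          simp_rw [← Finset.prod_mul_distrib, ite_pow]
      _ = ∏ e, ∑ c : Fin n, (if c = σ (b e) then (0 : ℤ) else 1) *
            (if c = σ (a e) then (closedWalkPoly (s + 1)).eval (n : ℤ) ^ p
              else (openWalkPoly (s + 1)).eval (n : ℤ) ^ p) := by
          rw [Finset.prod_univ_sum, Fintype.piFinset_univ]
      _ = _ := by
          refine Finset.prod_congr rfl fun e _ ↦ ?_
          rw [sum_ite_ite, Fintype.card_fin]
          simp only [eq_comm (a := σ (b e))]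
  · rintro (e | ⟨⟨e, j⟩, i⟩)
    · exact ⟨trivial, .inl ⟨rfl, rfl⟩⟩
    · refine ⟨⟨j.2, i.2⟩, .inl ⟨?_, ?_⟩⟩
      · refine Fin.cases rfl (fun i ↦ ?_) i
        rw [Sum.elim_inr, Fin.cons_succ]
        change onPath e j (i + 1) = pathNode a (s + 1) e j (i + 1)
        simp [pathNode, i.2.ne]
      · refine Fin.lastCases ?_ (fun i ↦ ?_) i
        · rw [Sum.elim_inr, Fin.snoc_last]
          change mid e = pathNode a (s + 1) e j (s + 1)
          simp [pathNode]
        · rw [Sum.elim_inr, Fin.snoc_castSucc]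
          change onPath e j (i + 1) = pathNode a (s + 1) e j (i + 1)
          simp [pathNode, i.2.ne]

-- The weights have the form z for unequal ends and w + z for equal ends, with z = C^p + (X-2)D^p
-- and w = D^p - C^p. Agreement at all natural numbers determines the polynomial.
open Polynomial in
theorem chromaticPolynomial_inflate (G : Graph α β) (fv : ι ≃ V(G)) (fe : ε ≃ E(G))
    (hab : ∀ e, G.IsLink (fe e) (fv (a e)) (fv (b e))) (s p : ℕ) :
    (inflate a b (s + 1) p).chromaticPolynomial = ∑ A : Finset ε,
      (closedWalkPoly (s + 1) ^ p + (X - 2) * openWalkPoly (s + 1) ^ p) ^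
        (Fintype.card ε - A.card) * (openWalkPoly (s + 1) ^ p - closedWalkPoly (s + 1) ^ p) ^ A.card *
        X ^ G.numComponents ((fun e ↦ (fe e : β)) '' (A : Set ε)) := by
  refine Polynomial.eq_of_infinite_eval_eq _ _ ((Set.infinite_range_of_injective
    (Nat.cast_injective (R := ℤ))).mono ?_)
  rintro _ ⟨n, rfl⟩
  rw [Set.mem_ofPred_eq, eval_chromaticPolynomial_inflate]
  have := G.sum_prod_ite_eq fv fe a b hab ((closedWalkPoly (s + 1)).eval (n : ℤ) ^ p +
    (n - 2) * (openWalkPoly (s + 1)).eval (n : ℤ) ^ p)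
    ((openWalkPoly (s + 1)).eval (n : ℤ) ^ p - (closedWalkPoly (s + 1)).eval (n : ℤ) ^ p) n
  rw [Polynomial.eval_finsetSum]
  simp only [eval_mul, eval_pow, eval_add, eval_sub, eval_X, eval_ofNat]
  rw [← this]
  refine Finset.sum_congr rfl fun σ _ ↦ Finset.prod_congr rfl fun e _ ↦ ?_
  congr 1
  ring

end Graph

/-! ### Uniform convergence and the location of zeros -/

section

open Filter Topology Metric

/-- By compactness |r| is bounded on K by some constant below 1, so the powers tend to 0 uniformly,
and F is uniformly continuous on the product of K with the closed unit disc. -/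
theorem tendstoUniformlyOn_comp_pow {F : ℂ → ℂ → ℂ} (hF : Continuous fun x : ℂ × ℂ ↦ F x.1 x.2)
    {K : Set ℂ} (hK : IsCompact K) {r : ℂ → ℂ} (hr : ContinuousOn r K) (hr1 : ∀ q ∈ K, ‖r q‖ < 1) :
    TendstoUniformlyOn (fun (p : ℕ) q ↦ F q (r q ^ p)) (fun q ↦ F q 0) atTop K := by
  obtain rfl | hne := K.eq_empty_or_nonempty
  · exact tendstoUniformlyOn_empty
  obtain ⟨q₁, hq₁, hmax⟩ := hK.exists_isMaxOn hne hr.norm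
  have huc := (hK.prod (isCompact_closedBall (0 : ℂ) 1)).uniformContinuousOn_of_continuous
    hF.continuousOn
  rw [Metric.uniformContinuousOn_iff] at huc
  rw [Metric.tendstoUniformlyOn_iff]
  intro ε hε
  obtain ⟨δ, hδ, h⟩ := huc ε hε
  have hpow := tendsto_pow_atTop_nhds_zero_of_lt_one (norm_nonneg (r q₁)) (hr1 q₁ hq₁)
  filter_upwards [hpow.eventually_lt_const hδ] with p hp q hq
  have hle : ‖r q ^ p‖ ≤ ‖r q₁‖ ^ p := by
    rw [norm_pow]
    exact pow_le_pow_left₀ (norm_nonneg _) (hmax hq) p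
  have hle1 : ‖r q ^ p‖ ≤ 1 := hle.trans (pow_le_one₀ (norm_nonneg _) (hr1 q₁ hq₁).le)
  refine h (q, 0) ⟨hq, by simp⟩ (q, r q ^ p) ⟨hq, by simpa using hle1⟩ ?_
  rw [Prod.dist_eq, dist_self, dist_zero_left]
  exact max_lt hδ (hle.trans_lt hp)

/-- A form of Hurwitz's theorem. -/
theorem eventually_exists_zero_of_tendstoUniformlyOn {U : Set ℂ} (hU : IsOpen U) {f : ℕ → ℂ → ℂ}
    {g : ℂ → ℂ} (hf : ∀ p, DifferentiableOn ℂ (f p) U) (hg : ContinuousOn g U)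
    (hfg : ∀ K, IsCompact K → K ⊆ U → TendstoUniformlyOn f g atTop K)
    {q₀ : ℂ} (hq₀ : q₀ ∈ U) (h0 : g q₀ = 0) (hne : ∀ᶠ q in 𝓝[≠] q₀, g q ≠ 0)
    {ε : ℝ} (hε : 0 < ε) : ∀ᶠ p in atTop, ∃ q ∈ U, ‖q - q₀‖ < ε ∧ f p q = 0 := by
  rw [eventually_nhdsWithin_iff, Metric.eventually_nhds_iff] at hne
  obtain ⟨δ, hδ, hne⟩ := hne
  obtain ⟨η, hη, hηU⟩ := Metric.isOpen_iff.1 hU q₀ hq₀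
  obtain ⟨ρ, hρ, hρm⟩ := exists_between (lt_min hε (lt_min hδ hη))
  obtain ⟨hρε, hρδ, hρη⟩ : ρ < ε ∧ ρ < δ ∧ ρ < η := by simpa using hρm
  have hball : closedBall q₀ ρ ⊆ U := (closedBall_subset_ball hρη).trans hηU
  have hsph : sphere q₀ ρ ⊆ U := sphere_subset_closedBall.trans hball
  obtain ⟨q₁, hq₁, hmin⟩ := (isCompact_sphere q₀ ρ).exists_isMinOn
    (NormedSpace.sphere_nonempty.2 hρ.le) (hg.mono hsph).norm
  have hm : 0 < ‖g q₁‖ := by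
    refine norm_pos_iff.2 (hne (y := q₁) ?_ ?_)
    · rwa [mem_sphere.1 hq₁]
    · rintro rfl
      simp [hρ.ne] at hq₁
  have hev := Metric.tendstoUniformlyOn_iff.1 (hfg _ (isCompact_closedBall q₀ ρ) hball)
    (‖g q₁‖ / 2) (half_pos hm)
  filter_upwards [hev] with p hp
  by_contra! hcon
  have hq (q) (hq : q ∈ closedBall q₀ ρ) : f p q ≠ 0 := by
    refine hcon q (hball hq) ?_
    rw [← dist_eq_norm]
    exact (mem_closedBall.1 hq).trans_lt hρε
  -- The maximum principle applies to 1/f_p: on the circle |f_p| is at least half the minimum of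
  -- |g|, hence also at the centre. But there g vanishes and |f_p| is smaller than that.
  have hd : DiffContOnCl ℂ (fun q ↦ (f p q)⁻¹) (ball q₀ ρ) := by
    refine DifferentiableOn.diffContOnCl ?_
    rw [closure_ball _ hρ.ne']
    exact ((hf p).mono hball).inv hq
  have hle := Complex.norm_le_of_forall_mem_frontier_norm_le (C := (‖g q₁‖ / 2)⁻¹) isBounded_ball hd
    (fun q hq' ↦ ?_) (subset_closure (mem_ball_self hρ))
  · rw [norm_inv, inv_le_inv₀ (norm_pos_iff.2 (hq _ (mem_closedBall_self hρ.le))) (half_pos hm)]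
      at hle
    have := hp q₀ (mem_closedBall_self hρ.le)
    rw [h0, dist_zero_left] at this
    exact this.not_ge hle
  · rw [frontier_ball _ hρ.ne'] at hq'
    have hqc := sphere_subset_closedBall hq'
    rw [norm_inv, inv_le_inv₀ (norm_pos_iff.2 (hq _ hqc)) (half_pos hm)]
    have h1 := hp q hqc
    have h2 : ‖g q₁‖ ≤ ‖g q‖ := hmin hq'
    have h3 := norm_sub_norm_le (g q) (f p q)
    rw [dist_eq_norm] at h1
    linarith

/-- A real polynomial changes sign at a root of odd multiplicity. -/
theorem Polynomial.eventually_mul_neg_of_odd_rootMultiplicity {P : Polynomial ℝ} {x : ℝ}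
    (h : Odd (P.rootMultiplicity x)) :
    ∀ᶠ d in 𝓝[>] (0 : ℝ), P.eval (x - d) * P.eval (x + d) < 0 := by
  have hP : P ≠ 0 := by
    rintro rfl
    simp at h
  obtain ⟨R, hR, hdvd⟩ := P.exists_eq_pow_rootMultiplicity_mul_and_not_dvd hP x
  have hR0 : R.eval x ≠ 0 := by rwa [Polynomial.dvd_iff_isRoot] at hdvd
  have hcont : Continuous fun d ↦ R.eval (x - d) * R.eval (x + d) := by fun_prop
  have hpos : ∀ᶠ d in 𝓝[>] (0 : ℝ), 0 < R.eval (x - d) * R.eval (x + d) := by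
    refine (hcont.continuousAt.eventually_const_lt ?_).filter_mono nhdsWithin_le_nhds
    simpa using mul_self_pos.2 hR0
  filter_upwards [hpos, self_mem_nhdsWithin] with d hd hd0
  set m := P.rootMultiplicity x
  have hd0 : 0 < d := hd0
  have h1 : P.eval (x - d) * P.eval (x + d) =
      -((d ^ m) ^ 2 * (R.eval (x - d) * R.eval (x + d))) := by
    rw [hR]
    simp only [Polynomial.eval_mul, Polynomial.eval_pow, Polynomial.eval_sub, Polynomial.eval_X,
      Polynomial.eval_C]
    rw [show x - d - x = -d by ring, show x + d - x = d by ring, h.neg_pow]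
    ring
  rw [h1]
  have : 0 < d ^ m := by positivity
  have := mul_pos (pow_pos this 2) hd
  linarith

theorem zero_notMem_regionQ {s : ℕ} : (0 : ℂ) ∉ regionQ s := by
  simp [regionQ]

theorem isOpen_regionQ (s : ℕ) : IsOpen (regionQ s) :=
  isOpen_lt (by fun_prop) (by fun_prop)

theorem mul_aeval_walkPoly (s : ℕ) (q : ℂ) :
    q * Polynomial.aeval q (closedWalkPoly s) = (q - 1) ^ s + (q - 1) * (-1) ^ s ∧
      q * Polynomial.aeval q (openWalkPoly s) = (q - 1) ^ s - (-1) ^ s := by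
  have h := X_mul_walkPolynomials s
  have h1 := congrArg (Polynomial.aeval q) h.1
  have h2 := congrArg (Polynomial.aeval q) h.2
  simpa using And.intro h1 h2

theorem cycleFactor_eq {s : ℕ} {q : ℂ} (hq : q ≠ 0) :
    cycleFactor s q = Polynomial.aeval q (closedWalkPoly s) := by
  rw [cycleFactor, ← (mul_aeval_walkPoly s q).1, mul_div_cancel_left₀ _ hq]

theorem norm_openWalk_lt {s : ℕ} {q : ℂ} (hq : q ∈ regionQ s) :
    ‖Polynomial.aeval q (openWalkPoly s)‖ < ‖Polynomial.aeval q (closedWalkPoly s)‖ := by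
  have hq0 : q ≠ 0 := fun h ↦ zero_notMem_regionQ (h ▸ hq)
  have h : ‖(q - 1) ^ s - (-1) ^ s‖ < ‖(q - 1) ^ s + (q - 1) * (-1) ^ s‖ := hq
  rw [← (mul_aeval_walkPoly s q).1, ← (mul_aeval_walkPoly s q).2, norm_mul, norm_mul] at h
  exact lt_of_mul_lt_mul_left h (norm_nonneg q)

namespace Graph

variable {α : Type u} {β : Type v} {ι : Type u} {ε : Type v} [Fintype ι] [DecidableEq ι]
  [Fintype ε] (a b : ε → ι)

/-- Dividing by C^p for every edge leaves a function of q and z = (D/C)^p that is polynomial in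
both. At z = 0 the two weight parameters are 1 and -1, which gives P_G. -/
theorem tendstoUniformlyOn_inflate (G : Graph α β) (fv : ι ≃ V(G)) (fe : ε ≃ E(G))
    (hab : ∀ e, G.IsLink (fe e) (fv (a e)) (fv (b e))) (s : ℕ) {K : Set ℂ} (hK : IsCompact K)
    (hKs : K ⊆ regionQ (s + 1)) :
    TendstoUniformlyOn (fun (p : ℕ) (q : ℂ) ↦
      (Polynomial.aeval q (closedWalkPoly (s + 1)) ^ (Fintype.card ε * p))⁻¹ *
        Polynomial.aeval q (inflate a b (s + 1) p).chromaticPolynomial)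
      (fun q ↦ Polynomial.aeval q G.chromaticPolynomial) atTop K := by
  classical
  let F (q z : ℂ) : ℂ := ∑ A : Finset ε, (1 + (q - 2) * z) ^ (Fintype.card ε - A.card) *
    (z - 1) ^ A.card * q ^ G.numComponents ((fun e ↦ (fe e : β)) '' (A : Set ε))
  have hC {q} (hq : q ∈ K) : Polynomial.aeval q (closedWalkPoly (s + 1)) ≠ 0 :=
    norm_pos_iff.1 ((norm_nonneg _).trans_lt (norm_openWalk_lt (hKs hq)))
  have key := tendstoUniformlyOn_comp_pow (F := F) (by fun_prop) hK (r := fun q ↦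
    Polynomial.aeval q (openWalkPoly (s + 1)) / Polynomial.aeval q (closedWalkPoly (s + 1)))
    ((Polynomial.continuous_aeval _).continuousOn.div (Polynomial.continuous_aeval _).continuousOn
      fun q hq ↦ hC hq)
    (fun q hq ↦ by
      rw [norm_div, div_lt_one (norm_pos_iff.2 (hC hq))]
      exact norm_openWalk_lt (hKs hq))
  refine (key.congr (.of_forall fun p q hq ↦ ?_)).congr_right fun q _ ↦ ?_
  · simp only [F]
    rw [chromaticPolynomial_inflate a b G fv fe hab s p, map_sum, Finset.mul_sum]
    refine Finset.sum_congr rfl fun A _ ↦ ?_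
    simp only [map_mul, map_pow, map_add, map_sub, Polynomial.aeval_X, map_ofNat]
    set c := Polynomial.aeval q (closedWalkPoly (s + 1))
    set d := Polynomial.aeval q (openWalkPoly (s + 1))
    have hc : c ^ p ≠ 0 := pow_ne_zero _ (hC hq)
    have hcard : Fintype.card ε = (Fintype.card ε - A.card) + A.card :=
      (Nat.sub_add_cancel A.card_le_univ).symm
    have h1 : c ^ (Fintype.card ε * p) = (c ^ p) ^ (Fintype.card ε - A.card) * (c ^ p) ^ A.card := by
      rw [← pow_add, ← hcard, ← pow_mul, mul_comm]
    have h2 : c ^ p + (q - 2) * d ^ p = c ^ p * (1 + (q - 2) * (d / c) ^ p) := by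
      rw [div_pow]; field_simp
    have h3 : d ^ p - c ^ p = c ^ p * ((d / c) ^ p - 1) := by
      rw [div_pow]; field_simp
    rw [h1, h2, h3, mul_pow, mul_pow, inv_mul_eq_div,
      eq_div_iff (mul_ne_zero (pow_ne_zero _ hc) (pow_ne_zero _ hc))]
    ring
  · simp [F, G.chromaticPolynomial_eq_sum fe]

end Graph

theorem Polynomial.eventually_aeval_ne_zero {P : Polynomial ℤ} (hP : P ≠ 0) (q₀ : ℂ) :
    ∀ᶠ q in 𝓝[≠] q₀, Polynomial.aeval q P ≠ 0 := by
  have hP' : P.map (Int.castRingHom ℂ) ≠ 0 :=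
    (Polynomial.map_ne_zero_iff (RingHom.injective_int _)).2 hP
  have hfin : ((P.map (Int.castRingHom ℂ)).rootSet ℂ \ {q₀}).Finite :=
    (Polynomial.rootSet_finite _ _).sdiff
  filter_upwards [nhdsWithin_le_nhds (hfin.isClosed.isOpen_compl.mem_nhds (x := q₀) (by simp)),
    self_mem_nhdsWithin] with q hq hq' h0
  refine hq ⟨?_, hq'⟩
  rw [Polynomial.mem_rootSet]
  refine ⟨hP', ?_⟩
  simpa [Polynomial.aeval_def, Polynomial.eval₂_map] using h0

/-- Convergence of normalised real polynomials produces real zeros near a zero of odd multiplicity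
of the limit. -/
theorem eventually_exists_real_zero {U : Set ℂ} (hU : IsOpen U) {C P : Polynomial ℤ}
    {Q : ℕ → Polynomial ℤ} {N : ℕ → ℕ} (hC : ∀ q ∈ U, Polynomial.aeval q C ≠ 0)
    (hlim : ∀ q ∈ U, Tendsto (fun p ↦ (Polynomial.aeval q C ^ N p)⁻¹ * Polynomial.aeval q (Q p))
      atTop (𝓝 (Polynomial.aeval q P)))
    {q₀ : ℝ} (hq₀ : (q₀ : ℂ) ∈ U)
    (hodd : Odd ((P.map (Int.castRingHom ℝ)).rootMultiplicity q₀)) {ε : ℝ} (hε : 0 < ε) :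
    ∀ᶠ p in atTop, ∃ q ∈ Set.Ioo (q₀ - ε) (q₀ + ε), Polynomial.aeval q (Q p) = 0 := by
  have hU' : IsOpen ((fun x : ℝ ↦ (x : ℂ)) ⁻¹' U) := hU.preimage Complex.continuous_ofReal
  obtain ⟨η, hη, hηU⟩ := Metric.isOpen_iff.1 hU' q₀ hq₀
  have hsmall : ∀ᶠ d in 𝓝[>] (0 : ℝ), d < min ε η :=
    nhdsWithin_le_nhds (Iio_mem_nhds (lt_min hε hη))
  obtain ⟨d, ⟨hd, hdlt⟩, hd0⟩ := (((Polynomial.eventually_mul_neg_of_odd_rootMultiplicity hodd).and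
    hsmall).and self_mem_nhdsWithin).exists
  have hd0 : 0 < d := hd0
  obtain ⟨hdε, hdη⟩ := lt_min_iff.1 hdlt
  have hmem {x} (hx : x ∈ Set.Icc (q₀ - d) (q₀ + d)) : (x : ℂ) ∈ U := by
    refine hηU (mem_ball.2 ?_)
    rw [Real.dist_eq, abs_lt]
    constructor <;> linarith [hx.1, hx.2]
  let f (p : ℕ) (x : ℝ) : ℝ := (Polynomial.aeval x C ^ N p)⁻¹ * Polynomial.aeval x (Q p)
  have hcast (x : ℝ) (R : Polynomial ℤ) :
      ((Polynomial.aeval x R : ℝ) : ℂ) = Polynomial.aeval (x : ℂ) R :=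
    (Polynomial.aeval_algebraMap_apply ℂ x R).symm
  have hCr {x} (hx : x ∈ Set.Icc (q₀ - d) (q₀ + d)) : Polynomial.aeval x C ≠ 0 := by
    intro h
    apply hC x (hmem hx)
    rw [← hcast, h, Complex.ofReal_zero]
  have hflim {x} (hx : x ∈ Set.Icc (q₀ - d) (q₀ + d)) :
      Tendsto (fun p ↦ f p x) atTop (𝓝 (Polynomial.aeval x P)) := by
    have h := (Complex.continuous_re.tendsto _).comp (hlim x (hmem hx))
    rw [← hcast x P, Complex.ofReal_re] at h
    refine h.congr fun p ↦ ?_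
    simp only [Function.comp, f]
    rw [← hcast, ← hcast, ← Complex.ofReal_pow, ← Complex.ofReal_inv, ← Complex.ofReal_mul,
      Complex.ofReal_re]
  have hl : q₀ - d ∈ Set.Icc (q₀ - d) (q₀ + d) := ⟨le_rfl, by linarith⟩
  have hr : q₀ + d ∈ Set.Icc (q₀ - d) (q₀ + d) := ⟨by linarith, le_rfl⟩
  have hneg : Polynomial.aeval (q₀ - d) P * Polynomial.aeval (q₀ + d) P < 0 := by
    simpa [Polynomial.eval_map, Polynomial.aeval_def] using hd
  -- Pointwise convergence at the two ends q₀ ± d transfers the sign change to the normalised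
  -- polynomials.
  filter_upwards [((hflim hl).mul (hflim hr)).eventually_lt_const hneg] with p hp
  have hcont : ContinuousOn (f p) (Set.Icc (q₀ - d) (q₀ + d)) :=
    (((Polynomial.continuous_aeval _).continuousOn.pow _).inv₀
      fun x hx ↦ pow_ne_zero _ (hCr hx)).mul (Polynomial.continuous_aeval _).continuousOn
  have hzero : ∃ x ∈ Set.Icc (q₀ - d) (q₀ + d), f p x = 0 := by
    obtain ⟨h1, h2⟩ | ⟨h1, h2⟩ := mul_neg_iff.1 hp
    · exact intermediate_value_Icc' (hl.2) hcont ⟨h2.le, h1.le⟩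
    · exact intermediate_value_Icc (hl.2) hcont ⟨h1.le, h2.le⟩
  obtain ⟨x, hx, hfx⟩ := hzero
  refine ⟨x, ⟨by linarith [hx.1], by linarith [hx.2]⟩, ?_⟩
  exact (mul_eq_zero.1 hfx).resolve_left (inv_ne_zero (pow_ne_zero _ (hCr hx)))

end

/-! ### Making a drawing radial near its vertices -/

section

open Filter Topology Metric unitInterval

/-- A ball in a chart is homeomorphic to the whole plane. Embedding all of ℂ makes the closed unit
disc compact in S and the open one open in S. -/
theorem exists_isOpenEmbedding_complex {S : Type*} [TopologicalSpace S]
    [ChartedSpace (EuclideanSpace ℝ (Fin 2)) S] {x : S} {U : Set S} (hU : U ∈ 𝓝 x) :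
    ∃ ψ : ℂ → S, IsOpenEmbedding ψ ∧ ψ 0 = x ∧ Set.range ψ ⊆ U := by
  set φ := chartAt (EuclideanSpace ℝ (Fin 2)) x
  have hx : x ∈ φ.source := mem_chart_source _ x
  have hmem : φ.target ∩ φ.symm ⁻¹' U ∈ 𝓝 (φ x) := by
    refine inter_mem (φ.open_target.mem_nhds (φ.map_source hx)) ?_
    refine (φ.continuousAt_symm (φ.map_source hx)).preimage_mem_nhds ?_
    rwa [φ.left_inv hx]
  obtain ⟨ρ, hρ, hball⟩ := Metric.mem_nhds_iff.1 hmem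
  set B := OpenPartialHomeomorph.univBall (φ x) ρ
  have hB (z) : B z ∈ ball (φ x) ρ := by
    rw [← OpenPartialHomeomorph.univBall_target (φ x) hρ]
    exact B.map_source (by simp [B])
  let e := B.trans φ.symm
  have he : e.source = Set.univ := by
    refine Set.eq_univ_of_forall fun z ↦ ?_
    simp only [e, OpenPartialHomeomorph.trans_source]
    exact ⟨by simp [B], (hball (hB z)).1⟩
  refine ⟨e ∘ Complex.orthonormalBasisOneI.repr,
    (e.isOpenEmbedding he).comp
      Complex.orthonormalBasisOneI.repr.toHomeomorph.isOpenEmbedding, ?_, ?_⟩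
  · simp [e, B, φ.left_inv hx]
  · rintro _ ⟨z, rfl⟩
    exact (hball (hB _)).2

/-- An arc leading from the centre of one disc to the centre of another one contains a subarc that
leads from the boundary of the first disc to the boundary of the second one and avoids both discs
otherwise. -/
theorem exists_subarc {S : Type*} [TopologicalSpace S] [T2Space S] {γ : I → S} (hγ : Continuous γ)
    {φ ψ : ℂ → S} (hφ : IsOpenEmbedding φ) (hψ : IsOpenEmbedding ψ)
    (hdisj : ∀ z w, φ z ≠ ψ w) (h0 : γ 0 = φ 0) (h1 : γ 1 = ψ 0) :
    ∃ t₀ t₁ : I, 0 < t₀ ∧ t₀ < t₁ ∧ t₁ < 1 ∧ (∃ z, ‖z‖ = 1 ∧ γ t₀ = φ z) ∧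
      (∃ z, ‖z‖ = 1 ∧ γ t₁ = ψ z) ∧
      (∀ t ∈ Set.Icc t₀ t₁, ∀ z, ‖z‖ ≤ 1 → γ t = φ z → t = t₀) ∧
      (∀ t ∈ Set.Icc t₀ t₁, ∀ z, ‖z‖ ≤ 1 → γ t = ψ z → t = t₁) := by
  have hcl {χ : ℂ → S} (hχ : IsOpenEmbedding χ) : IsClosed (γ ⁻¹' (χ '' closedBall 0 1)) :=
    (((isCompact_closedBall 0 1).image hχ.continuous).isClosed).preimage hγ
  have hop {χ : ℂ → S} (hχ : IsOpenEmbedding χ) : IsOpen (γ ⁻¹' (χ '' ball 0 1)) :=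
    (hχ.isOpenMap _ isOpen_ball).preimage hγ
  -- `t₀` is the last time in the first closed disc, and `t₁` will be the first later time in the
  -- second one. Were either point interior to its disc, a nearby time would contradict extremality.
  obtain ⟨t₀, ⟨z, hz, hzt⟩, hmax⟩ := (hcl hφ).isCompact.exists_isGreatest ⟨0, 0, by simp, h0.symm⟩
  have ht₀1 : t₀ < 1 := by
    refine lt_of_le_of_ne t₀.2.2 ?_
    rintro rfl
    exact hdisj z 0 (hzt.trans h1)
  obtain ⟨t₁, ⟨⟨w, hw, hwt⟩, ht₀₁⟩, hmin⟩ := ((hcl hψ).inter (isClosed_Ici (a := t₀))).isCompact.exists_isLeast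
    ⟨1, ⟨0, by simp, h1.symm⟩, t₀.2.2⟩
  have hlt : t₀ < t₁ := by
    refine lt_of_le_of_ne ht₀₁ ?_
    rintro rfl
    exact hdisj z w (hzt.trans hwt.symm)
  have hz1 : ‖z‖ = 1 := by
    refine le_antisymm (by simpa using hz) (not_lt.1 fun hlt' ↦ ?_)
    have hev : ∀ᶠ t in 𝓝[>] t₀, t ∈ γ ⁻¹' (φ '' ball 0 1) :=
      nhdsWithin_le_nhds ((hop hφ).mem_nhds ⟨z, by simpa using hlt', hzt⟩)
    have : (𝓝[>] t₀).NeBot := nhdsGT_neBot_of_exists_gt ⟨1, ht₀1⟩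
    obtain ⟨t, ht, htt⟩ := (hev.and self_mem_nhdsWithin).exists
    exact (hmax (Set.image_mono ball_subset_closedBall ht)).not_gt htt
  have hw1 : ‖w‖ = 1 := by
    refine le_antisymm (by simpa using hw) (not_lt.1 fun hlt' ↦ ?_)
    have hev : ∀ᶠ t in 𝓝[<] t₁, t ∈ γ ⁻¹' (ψ '' ball 0 1) ∩ Set.Ioi t₀ :=
      nhdsWithin_le_nhds (((hop hψ).inter isOpen_Ioi).mem_nhds
        ⟨⟨w, by simpa using hlt', hwt⟩, hlt⟩)
    have : (𝓝[<] t₁).NeBot := nhdsLT_neBot_of_exists_lt ⟨t₀, hlt⟩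
    obtain ⟨t, ht, htt⟩ := (hev.and self_mem_nhdsWithin).exists
    exact (hmin ⟨Set.image_mono ball_subset_closedBall ht.1, le_of_lt (Set.mem_Ioi.1 ht.2)⟩).not_gt htt
  refine ⟨t₀, t₁, ?_, hlt, ?_, ⟨z, hz1, hzt.symm⟩, ⟨w, hw1, hwt.symm⟩, ?_, ?_⟩
  · refine lt_of_le_of_ne t₀.2.1 ?_
    rintro rfl
    have := hφ.injective (hzt.trans h0)
    simp [this] at hz1
  · refine lt_of_le_of_ne t₁.2.2 ?_
    rintro rfl
    have := hψ.injective (hwt.trans h1)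
    simp [this] at hw1
  · exact fun t ht z hz h ↦ le_antisymm (hmax ⟨z, by simpa using hz, h.symm⟩) ht.1
  · exact fun t ht z hz h ↦ le_antisymm ht.2 (hmin ⟨⟨z, by simpa using hz, h.symm⟩, ht.1⟩)

/-- A drawing in which the vertices are the centres of disjoint discs, each edge consisting of a
radius of the disc at either end and of an arc outside of the discs. -/
structure DiscDrawing {ι : Type*} {ε : Type*} (a b : ε → ι) (S : Type*) [TopologicalSpace S] where
  /-- the coordinates around a vertex -/
  disc : ι → ℂ → S
  /-- the direction of an edge at its first end -/
  dirFst : ε → ℂ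
  /-- the direction of an edge at its second end -/
  dirSnd : ε → ℂ
  /-- the part of an edge outside of the discs -/
  outer : ε → I → S
  continuous_disc : ∀ x, Continuous (disc x)
  disc_inj : ∀ {x y z w}, disc x z = disc y w → x = y ∧ z = w
  continuous_outer : ∀ e, Continuous (outer e)
  norm_dirFst : ∀ e, ‖dirFst e‖ = 1
  norm_dirSnd : ∀ e, ‖dirSnd e‖ = 1
  outer_zero : ∀ e, outer e 0 = disc (a e) (dirFst e)
  outer_one : ∀ e, outer e 1 = disc (b e) (dirSnd e)
  outer_inj : ∀ {e f t t'}, outer e t = outer f t' → e = f ∧ t = t'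
  outer_ne_disc : ∀ {e t x z}, t ∈ Set.Ioo (0 : I) 1 → ‖z‖ ≤ 1 → outer e t ≠ disc x z

theorem exists_discDrawing {ι ε : Type*} [Finite ι] [Finite ε] {a b : ε → ι}
    (hne : ∀ e, a e ≠ b e) {S : Type*} [TopologicalSpace S] [T2Space S]
    [ChartedSpace (EuclideanSpace ℝ (Fin 2)) S] (pt : ι → S) (γ : ε → I → S)
    (hpt : Function.Injective pt) (hγ : ∀ e, Continuous (γ e)) (h0 : ∀ e, γ e 0 = pt (a e))
    (h1 : ∀ e, γ e 1 = pt (b e)) (hv : ∀ e, ∀ t ∈ Set.Ioo (0 : I) 1, ∀ x, γ e t ≠ pt x)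
    (he : ∀ e f, ∀ t ∈ Set.Ioo (0 : I) 1, ∀ t' ∈ Set.Ioo (0 : I) 1, γ e t = γ f t' →
      e = f ∧ t = t') :
    Nonempty (DiscDrawing a b S) := by
  obtain ⟨U, hU, hdisj⟩ := (Set.finite_range pt).t2_separation
  have hnot (x : ι) (e : ε) (hx : x ≠ a e ∧ x ≠ b e) : pt x ∉ Set.range (γ e) := by
    rintro ⟨t, ht⟩
    rcases t.2.1.eq_or_lt with h | h
    · obtain rfl : 0 = t := Subtype.ext h
      exact hx.1 (hpt (ht.symm.trans (h0 e)))
    rcases t.2.2.eq_or_lt with h' | h'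
    · obtain rfl : t = 1 := Subtype.ext h'
      exact hx.2 (hpt (ht.symm.trans (h1 e)))
    · exact hv e t ⟨h, h'⟩ x ht
  -- The disc at x is chosen inside its Hausdorff neighbourhood and off the compact images of all
  -- edges not incident with x, so only incident edges can enter it.
  have hN (x : ι) : U (pt x) ∩ ⋂ e ∈ {e | x ≠ a e ∧ x ≠ b e}, (Set.range (γ e))ᶜ ∈ 𝓝 (pt x) := by
    refine inter_mem ((hU (pt x)).2.mem_nhds (hU (pt x)).1) ?_
    rw [Filter.biInter_mem (Set.toFinite _)]
    exact fun e hx ↦ (isCompact_range (hγ e)).isClosed.isOpen_compl.mem_nhds (hnot x e hx)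
  choose ψ hψ hψ0 hψr using fun x ↦ exists_isOpenEmbedding_complex (hN x)
  have hψx {x y z w} (h : ψ x z = ψ y w) : x = y := by
    by_contra hxy
    have := hdisj ⟨x, rfl⟩ ⟨y, rfl⟩ (fun h ↦ hxy (hpt h))
    refine Set.disjoint_left.1 this (hψr x ⟨z, rfl⟩).1 ?_
    rw [h]
    exact (hψr y ⟨w, rfl⟩).1
  have hψγ {x e t z} (h : γ e t = ψ x z) : x = a e ∨ x = b e := by
    by_contra! hx
    have := (hψr x ⟨z, rfl⟩).2
    rw [Set.mem_iInter₂] at this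
    exact this e hx ⟨t, h⟩
  choose t₀ t₁ ht₀ ht₀₁ ht₁ hz hw hA hB using fun e ↦ exists_subarc (hγ e) (hψ (a e)) (hψ (b e))
    (fun z w h ↦ hne e (hψx h)) (by rw [h0, hψ0]) (by rw [h1, hψ0])
  choose z hz hzt using hz
  choose w hw hwt using hw
  -- Affine reparametrisation of the subarc between `t₀ e` and `t₁ e`; it avoids the discs at both
  -- ends except at its endpoints.
  let r (e : ε) (t : I) : I := ⟨t₀ e + t * (t₁ e - t₀ e), by
    have h1 : (t₀ e : ℝ) < t₁ e := ht₀₁ e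
    have h2 := (t₀ e).2.1
    have h3 := (t₁ e).2.2
    constructor
    · nlinarith [t.2.1]
    · nlinarith [t.2.2]⟩
  have hr (e t) : r e t ∈ Set.Icc (t₀ e) (t₁ e) := by
    have h1 : (t₀ e : ℝ) < t₁ e := ht₀₁ e
    constructor
    · change (t₀ e : ℝ) ≤ t₀ e + t * (t₁ e - t₀ e)
      nlinarith [t.2.1]
    · change (t₀ e : ℝ) + t * (t₁ e - t₀ e) ≤ t₁ e
      nlinarith [t.2.2]
  have hr0 (e) : r e 0 = t₀ e := by ext; simp [r]
  have hr1 (e) : r e 1 = t₁ e := by ext; simp [r]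
  have hrinj (e) : Function.Injective (r e) := by
    intro t t' h
    have h1 : (t₀ e : ℝ) < t₁ e := ht₀₁ e
    have h2 : (t₀ e : ℝ) + t * (t₁ e - t₀ e) = t₀ e + t' * (t₁ e - t₀ e) := congrArg Subtype.val h
    ext
    have h3 : (t₁ e - t₀ e : ℝ) ≠ 0 := (sub_pos.2 h1).ne'
    exact mul_right_cancel₀ h3 (by linarith)
  have hIoo (e t) : r e t ∈ Set.Ioo (0 : I) 1 :=
    ⟨(ht₀ e).trans_le (hr e t).1, (hr e t).2.trans_lt (ht₁ e)⟩
  exact ⟨{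
    disc := ψ
    dirFst := z
    dirSnd := w
    outer := fun e t ↦ γ e (r e t)
    continuous_disc := fun x ↦ (hψ x).continuous
    disc_inj := by
      intro x y z w h
      obtain rfl := hψx h
      exact ⟨rfl, (hψ x).injective h⟩
    continuous_outer := fun e ↦ (hγ e).comp (by fun_prop)
    norm_dirFst := hz
    norm_dirSnd := hw
    outer_zero := fun e ↦ by rw [hr0, hzt]
    outer_one := fun e ↦ by rw [hr1, hwt]
    outer_inj := by
      intro e f t t' h
      obtain ⟨rfl, h⟩ := he e f _ (hIoo e t) _ (hIoo f t') h
      exact ⟨rfl, hrinj e h⟩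
    outer_ne_disc := by
      intro e t x ζ ht hζ h
      rcases hψγ h with rfl | rfl
      · have := hA e _ (hr e t) ζ hζ h
        exact ht.1.ne' (hrinj e (this.trans (hr0 e).symm))
      · have := hB e _ (hr e t) ζ hζ h
        exact ht.2.ne (hrinj e (this.trans (hr1 e).symm)) }⟩

end

/-! ### Drawing the paths inside sectors -/

section

open Filter Topology Metric unitInterval

theorem Complex.eq_zero_of_exp_mul_I_eq_one {τ : ℝ} (hτ : |τ| < 1)
    (h : Complex.exp (τ * Complex.I) = 1) : τ = 0 := by
  obtain ⟨n, hn⟩ := Complex.exp_eq_one_iff.1 h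
  have h1 : (τ : ℂ) = n * (2 * Real.pi) :=
    mul_right_cancel₀ Complex.I_ne_zero (by rw [hn]; ring)
  have h2 : τ = n * (2 * Real.pi) := by exact_mod_cast h1
  have hn0 : n = 0 := by
    by_contra hn0
    have h3 : (1 : ℝ) ≤ |(n : ℝ)| := by exact_mod_cast Int.one_le_abs hn0
    rw [h2, abs_mul, abs_of_pos Real.two_pi_pos] at hτ
    nlinarith [Real.two_le_pi]
  simp [h2, hn0]

namespace DiscDrawing

variable {ι ε : Type*} {a b : ε → ι} {S : Type*} [TopologicalSpace S]

theorem dirFst_inj (D : DiscDrawing a b S) {e f : ε} (h : a e = a f)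
    (h' : D.dirFst e = D.dirFst f) : e = f :=
  (D.outer_inj (t := 0) (t' := 0) (by rw [D.outer_zero, D.outer_zero, h, h'])).1

theorem dirSnd_inj (D : DiscDrawing a b S) {e f : ε} (h : b e = b f)
    (h' : D.dirSnd e = D.dirSnd f) : e = f :=
  (D.outer_inj (t := 1) (t' := 1) (by rw [D.outer_one, D.outer_one, h, h'])).1

theorem dirFst_ne_dirSnd (D : DiscDrawing a b S) {e f : ε} (h : a e = b f) :
    D.dirFst e ≠ D.dirSnd f := fun h' ↦
  zero_ne_one (D.outer_inj (e := e) (f := f) (t := 0) (t' := 1)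
    (by rw [D.outer_zero, D.outer_one, h, h'])).2

/-- A number `δ` such that sectors of angle `δ` around the edges are disjoint. -/
def IsSector (D : DiscDrawing a b S) (δ : ℝ) : Prop := 0 < δ ∧
    (∀ e f, a e = a f → ∀ τ τ' : ℝ, 0 ≤ τ → τ ≤ δ → 0 ≤ τ' → τ' ≤ δ →
      D.dirFst e * Complex.exp (τ * Complex.I) = D.dirFst f * Complex.exp (τ' * Complex.I) →
      e = f ∧ τ = τ') ∧
    (∀ e f, a e = b f → ∀ τ : ℝ, 0 ≤ τ → τ ≤ δ →
      D.dirFst e * Complex.exp (τ * Complex.I) ≠ D.dirSnd f)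

theorem exists_isSector [Finite ε] (D : DiscDrawing a b S) : ∃ δ : ℝ, D.IsSector δ := by
  have hcont (e : ε) : Continuous fun τ : ℝ ↦ D.dirFst e * Complex.exp (τ * Complex.I) := by
    fun_prop
  have h1 (e f : ε) (h : a e = a f) : ∀ᶠ τ : ℝ in 𝓝 0,
      D.dirFst e * Complex.exp (τ * Complex.I) = D.dirFst f → e = f ∧ τ = 0 := by
    by_cases hef : e = f
    · subst hef
      filter_upwards [ball_mem_nhds (0 : ℝ) one_pos] with τ hτ hexp
      have hne : D.dirFst e ≠ 0 := norm_ne_zero_iff.1 (by rw [D.norm_dirFst]; exact one_ne_zero)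
      refine ⟨rfl, Complex.eq_zero_of_exp_mul_I_eq_one (by simpa using hτ) ?_⟩
      exact mul_left_cancel₀ hne (by rw [hexp, mul_one])
    · filter_upwards [(hcont e).continuousAt.eventually_ne (y := D.dirFst f)
        (by simpa using fun h' ↦ hef (D.dirFst_inj h h'))] with τ hτ hexp using absurd hexp hτ
  have h2 (e f : ε) (h : a e = b f) : ∀ᶠ τ : ℝ in 𝓝 0,
      D.dirFst e * Complex.exp (τ * Complex.I) ≠ D.dirSnd f :=
    (hcont e).continuousAt.eventually_ne (by simpa using D.dirFst_ne_dirSnd h)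
  have h1' : ∀ᶠ τ : ℝ in 𝓝 0, ∀ e f, a e = a f →
      D.dirFst e * Complex.exp (τ * Complex.I) = D.dirFst f → e = f ∧ τ = 0 := by
    simpa only [eventually_all] using h1
  have h2' : ∀ᶠ τ : ℝ in 𝓝 0, ∀ e f, a e = b f →
      D.dirFst e * Complex.exp (τ * Complex.I) ≠ D.dirSnd f := by
    simpa only [eventually_all] using h2
  obtain ⟨δ, hδ, hball⟩ := Metric.eventually_nhds_iff.1 (h1'.and h2')
  -- Only the difference of the two angles matters; halving turns the non-strict bounds into
  -- membership in the open ball.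
  refine ⟨δ / 2, half_pos hδ, fun e f h τ τ' h0 h1 h0' h1' heq ↦ ?_, fun e f h τ h0 h1 ↦ ?_⟩
  · have hd : dist (τ - τ') 0 < δ := by
      rw [Real.dist_eq, sub_zero, abs_lt]
      constructor <;> linarith
    have := (hball hd).1 e f h (by
      rw [Complex.ofReal_sub, sub_mul, Complex.exp_sub, ← mul_div_assoc, heq,
        mul_div_cancel_right₀ _ (Complex.exp_ne_zero _)])
    exact ⟨this.1, sub_eq_zero.1 this.2⟩
  · refine (hball ?_).2 e f h
    rw [Real.dist_eq, sub_zero, abs_lt]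
    constructor <;> linarith

/-- Points of the drawing: the point with coordinate `z` in the disc around `x`, or a point of the
outer part of an edge. -/
def decode (D : DiscDrawing a b S) : (ι × ℂ) ⊕ (ε × I) → S :=
  Sum.elim (fun x ↦ D.disc x.1 x.2) fun y ↦ D.outer y.1 y.2

/-- The relevant points of the drawing. -/
def codes (ι ε : Type*) : Set ((ι × ℂ) ⊕ (ε × I))
  | .inl x => ‖x.2‖ ≤ 1
  | .inr y => y.2 ∈ Set.Ioo (0 : I) 1

/-- Endpoints of outer arcs lie on disc boundaries and are coded there only; this is why `codes`
uses the open interval. -/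
theorem injOn_decode (D : DiscDrawing a b S) : Set.InjOn D.decode (codes ι ε) := by
  rintro (⟨x, z⟩ | ⟨e, t⟩) h (⟨y, w⟩ | ⟨f, t'⟩) h' heq
  · obtain ⟨rfl, rfl⟩ := D.disc_inj heq
    rfl
  · exact (D.outer_ne_disc h' h heq.symm).elim
  · exact (D.outer_ne_disc h h' heq).elim
  · obtain ⟨rfl, rfl⟩ := D.outer_inj heq
    rfl

/-- The `j`-th curve from a vertex to the midpoint of an edge. -/
noncomputable def sectorCurve (D : DiscDrawing a b S) (δ : ℝ) (e : ε) (j : ℕ) (t : ℝ) : ℂ :=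
  -- The radius grows from 0 to 1/2 while the angle shrinks to 0. The initial angles δ/(j+1) are
  -- distinct, so the curves share only the vertex and the point halfway along the radius of the
  -- edge, which is the midpoint vertex.
  (t / 2 : ℝ) * (D.dirFst e * Complex.exp ((δ / (j + 1) * (1 - t) : ℝ) * Complex.I))

/-- The edge from the midpoint of an edge to its second end. -/
noncomputable def linkCode (D : DiscDrawing a b S) (e : ε) (t : ℝ) : (ι × ℂ) ⊕ (ε × I) :=
  -- The three thirds are the outer half of the first radius, the outer arc, and the whole second
  -- radius run inwards.
  if t ≤ 1 / 3 then .inl (a e, (1 / 2 + 3 * t / 2 : ℝ) * D.dirFst e)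
  else if t < 2 / 3 then .inr (e, Set.projIcc 0 1 zero_le_one (3 * t - 1))
  else .inl (b e, (3 - 3 * t : ℝ) * D.dirSnd e)

/-- Codes of the points of the drawing of the inflation: original vertices, points on the paths,
and points on the remaining edges. -/
noncomputable def drawCode (D : DiscDrawing a b S) (δ : ℝ) :
    ι ⊕ (ε × ℕ × ℝ) ⊕ (ε × ℝ) → (ι × ℂ) ⊕ (ε × I)
  | .inl x => .inl (x, 0)
  | .inr (.inl (e, j, t)) => .inl (a e, D.sectorCurve δ e j t)
  | .inr (.inr (e, t)) => D.linkCode e t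

/-- The parameters of the vertices and of the interior points of edges of the inflation. -/
def drawParams (ι ε : Type*) : Set (ι ⊕ (ε × ℕ × ℝ) ⊕ (ε × ℝ))
  | .inl _ => True
  | .inr (.inl (_, _, t)) => t ∈ Set.Ioo 0 1
  | .inr (.inr (_, t)) => t ∈ Set.Ico 0 1

theorem norm_sectorCurve (D : DiscDrawing a b S) (δ : ℝ) (e : ε) (j : ℕ) {t : ℝ} (ht : 0 ≤ t) :
    ‖D.sectorCurve δ e j t‖ = t / 2 := by
  rw [sectorCurve, norm_mul, norm_mul, D.norm_dirFst, Complex.norm_exp_ofReal_mul_I,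
    Complex.norm_of_nonneg (by positivity)]
  ring

theorem norm_mul_dirFst (D : DiscDrawing a b S) (e : ε) {r : ℝ} (hr : 0 ≤ r) :
    ‖(r : ℂ) * D.dirFst e‖ = r := by
  rw [norm_mul, D.norm_dirFst, Complex.norm_of_nonneg hr, mul_one]

theorem norm_mul_dirSnd (D : DiscDrawing a b S) (e : ε) {r : ℝ} (hr : 0 ≤ r) :
    ‖(r : ℂ) * D.dirSnd e‖ = r := by
  rw [norm_mul, D.norm_dirSnd, Complex.norm_of_nonneg hr, mul_one]

theorem drawCode_mem (D : DiscDrawing a b S) (δ : ℝ) {x} (hx : x ∈ drawParams ι ε) :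
    D.drawCode δ x ∈ codes ι ε := by
  obtain x | ⟨e, j, t⟩ | ⟨e, t⟩ := x
  · change ‖(0 : ℂ)‖ ≤ 1
    simp
  · have ht : t ∈ Set.Ioo 0 1 := hx
    change ‖D.sectorCurve δ e j t‖ ≤ 1
    rw [D.norm_sectorCurve δ e j ht.1.le]
    linarith [ht.2]
  · have ht : t ∈ Set.Ico 0 1 := hx
    change D.linkCode e t ∈ codes ι ε
    unfold linkCode
    split_ifs with h1 h2
    · change ‖((1 / 2 + 3 * t / 2 : ℝ) : ℂ) * D.dirFst e‖ ≤ 1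
      rw [D.norm_mul_dirFst e (by linarith [ht.1])]
      linarith
    · change Set.projIcc (0 : ℝ) 1 zero_le_one (3 * t - 1) ∈ Set.Ioo (0 : I) 1
      have hm : 3 * t - 1 ∈ I := ⟨by linarith, by linarith⟩
      rw [Set.projIcc_of_mem _ hm]
      push Not at h1
      exact ⟨show (0 : ℝ) < 3 * t - 1 by linarith, show 3 * t - 1 < (1 : ℝ) by linarith⟩
    · change ‖((3 - 3 * t : ℝ) : ℂ) * D.dirSnd e‖ ≤ 1
      rw [D.norm_mul_dirSnd e (by linarith [ht.2])]
      linarith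

theorem IsSector.angle_mem {D : DiscDrawing a b S} {δ : ℝ} (hδ : D.IsSector δ) (j : ℕ) {t : ℝ}
    (ht : t ∈ Set.Icc 0 1) : 0 ≤ δ / (j + 1) * (1 - t) ∧ δ / (j + 1) * (1 - t) ≤ δ := by
  have h0 := hδ.1
  have h1 : 0 ≤ 1 - t := by linarith [ht.2]
  have h2 : δ / (j + 1) ≤ δ := div_le_self h0.le (by linarith [(Nat.cast_nonneg j : (0 : ℝ) ≤ j)])
  exact ⟨by positivity, (mul_le_of_le_one_right (by positivity) (by linarith [ht.1])).trans h2⟩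

theorem orig_ne_path {D : DiscDrawing a b S} (δ : ℝ) (x : ι) (e : ε) (j : ℕ) {t : ℝ}
    (ht : t ∈ Set.Ioo 0 1) :
    D.drawCode δ (.inl x) ≠ D.drawCode δ (.inr (.inl (e, j, t))) := by
  intro h
  have h1 : (0 : ℂ) = D.sectorCurve δ e j t := (Prod.ext_iff.1 (Sum.inl.inj h)).2
  have h2 := D.norm_sectorCurve δ e j ht.1.le
  rw [← h1, norm_zero] at h2
  linarith [ht.1]

theorem orig_ne_link {D : DiscDrawing a b S} (δ : ℝ) (x : ι) (e : ε) {t : ℝ}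
    (ht : t ∈ Set.Ico 0 1) :
    D.drawCode δ (.inl x) ≠ D.drawCode δ (.inr (.inr (e, t))) := by
  intro h
  simp only [drawCode, linkCode] at h
  split_ifs at h with h1 h2
  · have h3 := (Prod.ext_iff.1 (Sum.inl.inj h)).2
    simp only at h3
    have h4 := D.norm_mul_dirFst e (r := 1 / 2 + 3 * t / 2) (by linarith [ht.1])
    rw [← h3, norm_zero] at h4
    linarith [ht.1]
  · have h3 := (Prod.ext_iff.1 (Sum.inl.inj h)).2
    simp only at h3
    have h4 := D.norm_mul_dirSnd e (r := 3 - 3 * t) (by linarith [ht.2])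
    rw [← h3, norm_zero] at h4
    linarith [ht.2]

/-- Paths stay at radius below 1/2, whereas the link leaves its first disc at radius at least 1/2.
On a final radius the direction lies outside the sector. -/
theorem path_ne_link {D : DiscDrawing a b S} {δ : ℝ} (hδ : D.IsSector δ) (e f : ε) (j : ℕ)
    {t t' : ℝ} (ht : t ∈ Set.Ioo 0 1) (ht' : t' ∈ Set.Ico 0 1) :
    D.drawCode δ (.inr (.inl (e, j, t))) ≠ D.drawCode δ (.inr (.inr (f, t'))) := by
  intro h
  simp only [drawCode, linkCode] at h
  have hn := D.norm_sectorCurve δ e j ht.1.le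
  split_ifs at h with h1 h2
  · have h3 := (Prod.ext_iff.1 (Sum.inl.inj h)).2
    simp only at h3
    have h4 := D.norm_mul_dirFst f (r := 1 / 2 + 3 * t' / 2) (by linarith [ht'.1])
    rw [← h3, hn] at h4
    linarith [ht'.1, ht.2]
  · obtain ⟨h5, h3⟩ := Prod.ext_iff.1 (Sum.inl.inj h)
    simp only at h3 h5
    have h4 := D.norm_mul_dirSnd f (r := 3 - 3 * t') (by linarith [ht'.2])
    rw [← h3, hn] at h4
    have hr : ((3 - 3 * t' : ℝ) : ℂ) ≠ 0 := by
      rw [Complex.ofReal_ne_zero]; linarith [ht'.2]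
    rw [sectorCurve, h4] at h3
    obtain ⟨h6, h7⟩ := hδ.angle_mem j ⟨ht.1.le, ht.2.le⟩
    exact hδ.2.2 e f h5 _ h6 h7 (mul_left_cancel₀ hr h3)

/-- The radius determines t, disjointness of sectors determines the edge and the angle, and the
angle determines j because t ≠ 1. -/
theorem path_inj {D : DiscDrawing a b S} {δ : ℝ} (hδ : D.IsSector δ) {e f : ε} {j j' : ℕ}
    {t t' : ℝ} (ht : t ∈ Set.Ioo 0 1) (ht' : t' ∈ Set.Ioo 0 1)
    (h : D.drawCode δ (.inr (.inl (e, j, t))) = D.drawCode δ (.inr (.inl (f, j', t')))) :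
    e = f ∧ j = j' ∧ t = t' := by
  obtain ⟨h5, h3⟩ := Prod.ext_iff.1 (Sum.inl.inj h)
  simp only at h3 h5
  have hn := D.norm_sectorCurve δ e j ht.1.le
  rw [h3, D.norm_sectorCurve δ f j' ht'.1.le] at hn
  obtain rfl : t = t' := by linarith
  have hr : ((t / 2 : ℝ) : ℂ) ≠ 0 := by
    rw [Complex.ofReal_ne_zero]; linarith [ht.1]
  obtain ⟨h6, h7⟩ := hδ.angle_mem j ⟨ht.1.le, ht.2.le⟩
  obtain ⟨h6', h7'⟩ := hδ.angle_mem j' ⟨ht.1.le, ht.2.le⟩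
  obtain ⟨rfl, h8⟩ := hδ.2.1 e f h5 _ _ h6 h7 h6' h7' (mul_left_cancel₀ hr h3)
  refine ⟨rfl, ?_, rfl⟩
  have h9 : δ / (j + 1) = δ / (j' + 1) := mul_right_cancel₀ (by linarith [ht.2]) h8
  rw [div_eq_div_iff (by positivity) (by positivity)] at h9
  have h10 := mul_left_cancel₀ hδ.1.ne' h9
  have h11 : (j' : ℝ) = j := by linarith
  exact_mod_cast h11.symm

theorem link_inj {D : DiscDrawing a b S} {δ : ℝ} {e f : ε} {t t' : ℝ}
    (ht : t ∈ Set.Ico 0 1) (ht' : t' ∈ Set.Ico 0 1)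
    (h : D.drawCode δ (.inr (.inr (e, t))) = D.drawCode δ (.inr (.inr (f, t')))) :
    e = f ∧ t = t' := by
  simp only [drawCode, linkCode] at h
  -- An initial and a final radius at the same vertex have different directions.
  have hfs {e f : ε} {t t' : ℝ} (h1 : t ≤ 1 / 3) (ht : t ∈ Set.Ico 0 1) (ht' : t' ∈ Set.Ico 0 1)
      (h : (Sum.inl (a e, (1 / 2 + 3 * t / 2 : ℝ) * D.dirFst e) : (ι × ℂ) ⊕ (ε × I)) =
        .inl (b f, (3 - 3 * t' : ℝ) * D.dirSnd f)) : False := by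
    obtain ⟨h5, h3⟩ := Prod.ext_iff.1 (Sum.inl.inj h)
    simp only at h3 h5
    have h4 := D.norm_mul_dirFst e (r := 1 / 2 + 3 * t / 2) (by linarith [ht.1])
    have h6 := D.norm_mul_dirSnd f (r := 3 - 3 * t') (by linarith [ht'.2])
    rw [← h3, h4] at h6
    have hr : ((3 - 3 * t' : ℝ) : ℂ) ≠ 0 := by
      rw [Complex.ofReal_ne_zero]; linarith [ht'.2]
    rw [h6] at h3
    exact D.dirFst_ne_dirSnd h5 (mul_left_cancel₀ hr h3)
  split_ifs at h with h1 h2 h3 h4 h5 h6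
  · obtain ⟨h5, h3⟩ := Prod.ext_iff.1 (Sum.inl.inj h)
    simp only at h3 h5
    have h4 := D.norm_mul_dirFst e (r := 1 / 2 + 3 * t / 2) (by linarith [ht.1])
    have h6 := D.norm_mul_dirFst f (r := 1 / 2 + 3 * t' / 2) (by linarith [ht'.1])
    rw [← h3, h4] at h6
    have hr : ((1 / 2 + 3 * t' / 2 : ℝ) : ℂ) ≠ 0 := by
      rw [Complex.ofReal_ne_zero]; linarith [ht'.1]
    rw [h6] at h3
    exact ⟨D.dirFst_inj h5 (mul_left_cancel₀ hr h3), by linarith⟩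
  · exact (hfs h1 ht ht' h).elim
  · obtain ⟨h7, h8⟩ := Prod.ext_iff.1 (Sum.inr.inj h)
    simp only at h7 h8
    push Not at h1
    rw [Set.projIcc_of_mem _ (show 3 * t - 1 ∈ I from ⟨by linarith, by linarith⟩),
      Set.projIcc_of_mem _ (show 3 * t' - 1 ∈ I from ⟨by linarith, by linarith⟩),
      Subtype.mk.injEq] at h8
    exact ⟨h7, by linarith⟩
  · exact (hfs (by assumption) ht' ht h.symm).elim
  · obtain ⟨h5, h3⟩ := Prod.ext_iff.1 (Sum.inl.inj h)
    simp only at h3 h5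
    have h4 := D.norm_mul_dirSnd e (r := 3 - 3 * t) (by linarith [ht.2])
    have h6 := D.norm_mul_dirSnd f (r := 3 - 3 * t') (by linarith [ht'.2])
    rw [← h3, h4] at h6
    have hr : ((3 - 3 * t' : ℝ) : ℂ) ≠ 0 := by
      rw [Complex.ofReal_ne_zero]; linarith [ht'.2]
    rw [h6] at h3
    exact ⟨D.dirSnd_inj h5 (mul_left_cancel₀ hr h3), by linarith⟩

/-- This one injectivity statement contains all the non-crossing conditions. Link parameters include
0, which stands for the midpoint vertex. -/
theorem injOn_drawCode {D : DiscDrawing a b S} {δ : ℝ} (hδ : D.IsSector δ) :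
    Set.InjOn (D.drawCode δ) (drawParams ι ε) := by
  rintro (x | ⟨e, j, t⟩ | ⟨e, t⟩) h (y | ⟨f, j', t'⟩ | ⟨f, t'⟩) h' heq
  · have : x = y := (Prod.ext_iff.1 (Sum.inl.inj heq)).1
    rw [this]
  · exact (orig_ne_path δ x f j' h' heq).elim
  · exact (orig_ne_link δ x f h' heq).elim
  · exact (orig_ne_path δ y e j h heq.symm).elim
  · obtain ⟨rfl, rfl, rfl⟩ := path_inj hδ h h' heq
    rfl
  · exact (path_ne_link hδ e f j h h' heq).elim
  · exact (orig_ne_link δ y e h heq.symm).elim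
  · exact (path_ne_link hδ f e j' h' h heq.symm).elim
  · obtain ⟨rfl, rfl⟩ := link_inj h h' heq
    rfl

/-- The point of the surface with given parameters. -/
noncomputable def draw (D : DiscDrawing a b S) (δ : ℝ) (x : ι ⊕ (ε × ℕ × ℝ) ⊕ (ε × ℝ)) : S :=
  D.decode (D.drawCode δ x)

theorem injOn_draw {D : DiscDrawing a b S} {δ : ℝ} (hδ : D.IsSector δ) :
    Set.InjOn (D.draw δ) (drawParams ι ε) := fun _ hx _ hy h ↦
  injOn_drawCode hδ hx hy (D.injOn_decode (D.drawCode_mem δ hx) (D.drawCode_mem δ hy) h)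

theorem continuous_draw_path (D : DiscDrawing a b S) (δ : ℝ) (e : ε) (j : ℕ) :
    Continuous fun t ↦ D.draw δ (.inr (.inl (e, j, t))) :=
  (D.continuous_disc (a e)).comp (by unfold sectorCurve; fun_prop)

theorem continuous_draw_link (D : DiscDrawing a b S) (δ : ℝ) (e : ε) :
    Continuous fun t ↦ D.draw δ (.inr (.inr (e, t))) := by
  -- At t = 2/3 the outer arc and the last radius agree, so the strict inequality may be replaced by
  -- the one needed for gluing.
  have h (t : ℝ) : D.draw δ (.inr (.inr (e, t))) =
      if t ≤ 1 / 3 then D.disc (a e) ((1 / 2 + 3 * t / 2 : ℝ) * D.dirFst e)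
      else if t ≤ 2 / 3 then D.outer e (Set.projIcc 0 1 zero_le_one (3 * t - 1))
      else D.disc (b e) ((3 - 3 * t : ℝ) * D.dirSnd e) := by
    simp only [draw, drawCode, linkCode]
    rcases lt_trichotomy t (2 / 3) with h | rfl | h
    · simp only [h, h.le, if_true]
      split_ifs <;> rfl
    · norm_num [decode, D.outer_one]
    · rw [if_neg (by linarith), if_neg (by linarith), if_neg (by linarith), if_neg (by linarith)]
      rfl
  simp_rw [h]
  refine Continuous.if_le ((D.continuous_disc _).comp (by fun_prop)) (Continuous.if_le
    ((D.continuous_outer e).comp (by fun_prop)) ((D.continuous_disc _).comp (by fun_prop))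
    continuous_id continuous_const ?_) continuous_id continuous_const ?_
  · rintro t rfl
    norm_num [D.outer_one]
  · rintro t rfl
    norm_num [D.outer_zero]

theorem draw_path_zero (D : DiscDrawing a b S) (δ : ℝ) (e : ε) (j : ℕ) :
    D.draw δ (.inr (.inl (e, j, 0))) = D.draw δ (.inl (a e)) := by
  simp [draw, drawCode, sectorCurve]

theorem draw_path_one (D : DiscDrawing a b S) (δ : ℝ) (e : ε) (j : ℕ) :
    D.draw δ (.inr (.inl (e, j, 1))) = D.draw δ (.inr (.inr (e, 0))) := by
  simp [draw, drawCode, sectorCurve, linkCode]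

theorem draw_link_one (D : DiscDrawing a b S) (δ : ℝ) (e : ε) :
    D.draw δ (.inr (.inr (e, 1))) = D.draw δ (.inl (b e)) := by
  norm_num [draw, drawCode, linkCode]

end DiscDrawing

end

/-! ### Embedding the inflation in the surface -/

section

open Filter Topology Metric unitInterval

theorem Nat.eq_of_add_eq_add_of_mem_Ico {i j : ℕ} {t t' : ℝ} (ht : t ∈ Set.Ico 0 1)
    (ht' : t' ∈ Set.Ico 0 1) (h : i + t = j + t') : i = j := by
  have h1 : (i : ℝ) < j + 1 := by linarith [ht.1, ht'.2]
  have h2 : (j : ℝ) < i + 1 := by linarith [ht'.1, ht.2]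
  norm_cast at h1 h2
  omega

namespace Graph

open InflVertex InflEdge DiscDrawing

section

variable {ι : Type u} {ε : Type v} {a b : ε → ι} {s p : ℕ}

/-- The parameter of a vertex of the inflation in the drawing. -/
noncomputable def vertexParam (s : ℕ) : InflVertex ι ε → ι ⊕ (ε × ℕ × ℝ) ⊕ (ε × ℝ)
  | orig x => .inl x
  | mid e => .inr (.inr (e, 0))
  | onPath e j i => .inr (.inl (e, j, i / s))

/-- The parameter of a point on an edge of the inflation in the drawing. -/
noncomputable def edgeParam (s : ℕ) : InflEdge ι ε → ℝ → ι ⊕ (ε × ℕ × ℝ) ⊕ (ε × ℝ)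
  | link e, t => .inr (.inr (e, t))
  | seg e j i, t => .inr (.inl (e, j, (i + t) / s))

theorem vertexParam_mem {x : InflVertex ι ε} (hx : x ∈ inflVertexSet ι ε s p) :
    vertexParam s x ∈ drawParams ι ε := by
  obtain x | e | ⟨e, j, i⟩ := x
  · trivial
  · change (0 : ℝ) ∈ Set.Ico 0 1
    simp
  · obtain ⟨-, h0, h1⟩ : j < p ∧ 0 < i ∧ i < s := hx
    change (i / s : ℝ) ∈ Set.Ioo 0 1
    have hs : (0 : ℝ) < s := by exact_mod_cast h0.trans h1
    exact ⟨div_pos (by exact_mod_cast h0) hs, (div_lt_one hs).2 (by exact_mod_cast h1)⟩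

theorem edgeParam_mem {f : InflEdge ι ε} (hf : f ∈ inflEdgeSet ι ε s p) {t : ℝ}
    (ht : t ∈ Set.Ioo 0 1) : edgeParam s f t ∈ drawParams ι ε := by
  obtain e | ⟨e, j, i⟩ := f
  · exact Set.Ioo_subset_Ico_self ht
  · obtain ⟨-, h1⟩ : j < p ∧ i < s := hf
    change ((i + t) / s : ℝ) ∈ Set.Ioo 0 1
    have hs : (0 : ℝ) < s := by exact_mod_cast (Nat.zero_le i).trans_lt h1
    have h2 : (i + 1 : ℝ) ≤ s := by exact_mod_cast h1
    exact ⟨div_pos (by linarith [ht.1, (Nat.cast_nonneg i : (0 : ℝ) ≤ i)]) hs,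
      (div_lt_one hs).2 (by linarith [ht.2])⟩

theorem vertexParam_injective (hs : 0 < s) :
    Function.Injective (vertexParam s : InflVertex ι ε → _) := by
  have hs : (s : ℝ) ≠ 0 := by exact_mod_cast hs.ne'
  rintro (x | e | ⟨e, j, i⟩) (y | f | ⟨f, j', i'⟩) h <;> simp_all [vertexParam, div_left_inj' hs]

theorem edgeParam_ne_vertexParam (hs : 0 < s) (f : InflEdge ι ε) (x : InflVertex ι ε) {t : ℝ}
    (ht : t ∈ Set.Ioo 0 1) : edgeParam s f t ≠ vertexParam s x := by
  have hs : (s : ℝ) ≠ 0 := by exact_mod_cast hs.ne'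
  obtain e | ⟨e, j, i⟩ := f <;> obtain x | f | ⟨f, j', i'⟩ := x <;>
    simp only [edgeParam, vertexParam, ne_eq, reduceCtorEq, not_false_eq_true, Sum.inr.injEq,
      Sum.inl.injEq, Prod.mk.injEq, not_and, div_left_inj' hs]
  · exact fun _ ↦ ht.1.ne'
  · intro _ _ h
    have : i = i' := Nat.eq_of_add_eq_add_of_mem_Ico (t' := 0) ⟨ht.1.le, ht.2⟩ (by simp)
      (by rw [h, add_zero])
    subst this
    linarith [ht.1]

theorem edgeParam_inj (hs : 0 < s) {f g : InflEdge ι ε} {t t' : ℝ} (ht : t ∈ Set.Ioo 0 1)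
    (ht' : t' ∈ Set.Ioo 0 1) (h : edgeParam s f t = edgeParam s g t') : f = g ∧ t = t' := by
  have hs : (s : ℝ) ≠ 0 := by exact_mod_cast hs.ne'
  obtain e | ⟨e, j, i⟩ := f <;> obtain e' | ⟨e', j', i'⟩ := g <;>
    simp only [edgeParam, reduceCtorEq, Sum.inr.injEq, Sum.inl.injEq, Prod.mk.injEq,
      div_left_inj' hs] at h
  · exact ⟨by rw [h.1], h.2⟩
  · obtain ⟨rfl, rfl, h⟩ := h
    obtain rfl : i = i' := Nat.eq_of_add_eq_add_of_mem_Ico ⟨ht.1.le, ht.2⟩ ⟨ht'.1.le, ht'.2⟩ h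
    exact ⟨rfl, by linarith⟩

theorem draw_pathNode {S : Type*} [TopologicalSpace S] (D : DiscDrawing a b S) (δ : ℝ)
    (hs : 0 < s) (e : ε) (j i : ℕ) :
    D.draw δ (vertexParam s (pathNode a s e j i)) = D.draw δ (.inr (.inl (e, j, (i / s : ℝ)))) := by
  unfold pathNode
  split_ifs with h0 h1
  · simp [vertexParam, h0, draw_path_zero]
  · have hs : (s : ℝ) ≠ 0 := by exact_mod_cast hs.ne'
    simp [vertexParam, h1, div_self hs, draw_path_one]
  · rfl

/-- Each path is cut into s pieces of equal parameter length. Parameters of vertices and of interior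
edge points are pairwise distinct, and `draw` is injective on them. -/
theorem inflate_embeddableOn [Finite ε] (hs : 0 < s) {S : Type*} [TopologicalSpace S]
    (D : DiscDrawing a b S) : (inflate a b s p).EmbeddableOn S := by
  obtain ⟨δ, hδ⟩ := D.exists_isSector
  have hcont (f : InflEdge ι ε) : Continuous fun t : I ↦ D.draw δ (edgeParam s f t) := by
    obtain e | ⟨e, j, i⟩ := f
    · exact (D.continuous_draw_link δ e).comp continuous_subtype_val
    · exact (D.continuous_draw_path δ e j).comp (f := fun t : I ↦ ((i + t) / s : ℝ)) (by fun_prop)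
  have hinj := injOn_draw hδ
  refine ⟨fun x ↦ D.draw δ (vertexParam s x), fun f ↦ ⟨_, hcont f⟩, ?_, ?_, ?_, ?_⟩
  · intro x y h
    exact Subtype.ext (vertexParam_injective hs (hinj (vertexParam_mem x.2) (vertexParam_mem y.2) h))
  · rintro ⟨f, hf⟩ x y hxy
    have key : s(D.draw δ (edgeParam s f 0), D.draw δ (edgeParam s f 1)) =
        s(D.draw δ (vertexParam s (inflFst a s f)), D.draw δ (vertexParam s (inflSnd a b s f))) := by
      obtain e | ⟨e, j, i⟩ := f
      · simp only [edgeParam, inflFst, inflSnd, vertexParam, draw_link_one]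
      · simp only [edgeParam, inflFst, inflSnd, draw_pathNode D δ hs, add_zero, Nat.cast_add,
          Nat.cast_one]
    have hxy' := ((inflate_isLink ..).1 hxy).2
    refine key.trans ?_
    change _ = s(D.draw δ (vertexParam s x), D.draw δ (vertexParam s y))
    rcases hxy' with ⟨h1, h2⟩ | ⟨h1, h2⟩
    · rw [h1, h2]
    · rw [h1, h2, Sym2.eq_swap]
  · intro f t ht x h
    have ht' : (t : ℝ) ∈ Set.Ioo 0 1 := ht
    exact edgeParam_ne_vertexParam hs (f : InflEdge ι ε) (x : InflVertex ι ε) ht'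
      (hinj (edgeParam_mem f.2 ht') (vertexParam_mem x.2) h)
  · intro f g t ht t' ht' h
    have hT : (t : ℝ) ∈ Set.Ioo 0 1 := ht
    have hT' : (t' : ℝ) ∈ Set.Ioo 0 1 := ht'
    obtain ⟨h1, h2⟩ := edgeParam_inj hs hT hT'
      (hinj (edgeParam_mem f.2 hT) (edgeParam_mem g.2 hT') h)
    exact ⟨Subtype.ext h1, Subtype.ext h2⟩

end

/-- Arcs of an embedding carry no orientation, so those running from `b e` to `a e` are reversed
first. -/
theorem EmbeddableOn.exists_discDrawing {α : Type u} {β : Type v} {G : Graph α β} [Finite V(G)]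
    [Finite E(G)] (hG : G.Loopless) {a b : E(G) → V(G)} (hab : ∀ e : E(G), G.IsLink e (a e) (b e))
    {S : Type w} [TopologicalSpace S] [T2Space S] [ChartedSpace (EuclideanSpace ℝ (Fin 2)) S]
    (h : G.EmbeddableOn S) : Nonempty (DiscDrawing a b S) := by
  obtain ⟨pt, arc, hpt, hends, hv, he⟩ := h
  have hr (e : E(G)) : ∃ r : I → I, Continuous r ∧ Function.Injective r ∧
      (∀ t ∈ Set.Ioo (0 : I) 1, r t ∈ Set.Ioo (0 : I) 1) ∧
      arc e (r 0) = pt (a e) ∧ arc e (r 1) = pt (b e) := by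
    rcases Sym2.eq_iff.1 (hends e (a e) (b e) (hab e)) with ⟨h0, h1⟩ | ⟨h0, h1⟩
    · exact ⟨id, continuous_id, Function.injective_id, fun t ht ↦ ht, h0, h1⟩
    · refine ⟨unitInterval.symm, unitInterval.continuous_symm, unitInterval.symm_bijective.injective,
        fun t ht ↦ ?_, by simpa using h1, by simpa using h0⟩
      constructor
      · change (0 : ℝ) < 1 - t
        linarith [show (t : ℝ) < 1 from ht.2]
      · change (1 - t : ℝ) < 1
        linarith [show (0 : ℝ) < t from ht.1]
  choose r hrc hri hrm h0 h1 using hr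
  refine _root_.exists_discDrawing (fun e h ↦ ?_) pt (fun e t ↦ arc e (r e t)) hpt
    (fun e ↦ (arc e).continuous.comp (hrc e)) h0 h1 (fun e t ht x ↦ hv e _ (hrm e t ht) x) ?_
  · have hl := hab e
    rw [h] at hl
    exact hG.not_isLoopAt _ _ hl
  · intro e f t ht t' ht' h
    obtain ⟨rfl, h⟩ := he e f _ (hrm e t ht) _ (hrm f t' ht') h
    exact ⟨rfl, hri e h⟩

theorem IsConnected.eqvGen {α : Type u} {β : Type v} {G : Graph α β} {a b : E(G) → V(G)}
    (hab : ∀ e : E(G), G.IsLink e (a e) (b e)) (h : G.IsConnected) (x y : V(G)) :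
    Relation.EqvGen (fun x y ↦ ∃ e, x = a e ∧ y = b e) x y := by
  obtain ⟨w⟩ := h.preconnected x y
  induction w with
  | nil => exact .refl _
  | cons hadj w ih =>
    refine .trans _ _ _ ?_ ih
    obtain ⟨-, e, he⟩ := hadj
    rcases (hab ⟨e, he.edge_mem⟩).eq_and_eq_or_eq_and_eq he with ⟨h1, h2⟩ | ⟨h1, h2⟩
    · exact .rel _ _ ⟨⟨e, he.edge_mem⟩, Subtype.ext h1.symm, Subtype.ext h2.symm⟩
    · exact .symm _ _ (.rel _ _ ⟨⟨e, he.edge_mem⟩, Subtype.ext h1.symm, Subtype.ext h2.symm⟩)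

end Graph

end

/-! ### Assembly of the theorem -/

theorem theoremB1 {α : Type u} {β : Type v} (G : Graph α β)
    (hV : V(G).Finite) (hE : E(G).Finite) (hG : G.Loopless) (s : ℕ) (hs : 2 ≤ s) :
    ∃ (V' E' : Type (max u v)) (G' : ℕ → Graph V' E') (k : ℕ),
      -- the graphs `G'(p)`, `p ≥ 1`, are finite, 2-degenerate and 3-colorable
      (∀ p ≥ 1, V(G' p).Finite ∧ E(G' p).Finite ∧ (G' p).IsDegenerate 2 ∧ (G' p).Colorable 3) ∧
      -- (a) convergence
      (∀ K : Set ℂ, IsCompact K → K ⊆ regionQ s →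
        TendstoUniformlyOn
          (fun (p : ℕ) (q : ℂ) ↦
            (cycleFactor s q ^ (k * p))⁻¹ * Polynomial.aeval q (G' p).chromaticPolynomial)
          (fun q ↦ Polynomial.aeval q G.chromaticPolynomial) Filter.atTop K) ∧
      -- (b) connectedness
      (G.IsConnected → ∀ p ≥ 1, (G' p).IsConnected) ∧
      -- (c) bipartiteness
      (Even s → G.IsBipartite → ∀ p ≥ 1, (G' p).IsBipartite) ∧
      -- (d) embeddability on surfaces
      (∀ (S : Type w) [TopologicalSpace S] [T2Space S] [ChartedSpace (EuclideanSpace ℝ (Fin 2)) S],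
        G.EmbeddableOn S → ∀ p ≥ 1, (G' p).EmbeddableOn S) ∧
      -- (i) complex zeros
      (∀ q₀ ∈ regionQ s, Polynomial.aeval q₀ G.chromaticPolynomial = 0 →
        ∀ ε > 0, ∀ᶠ p in Filter.atTop, ∃ q : ℂ, ‖q - q₀‖ < ε ∧
          Polynomial.aeval q (G' p).chromaticPolynomial = 0) ∧
      -- (ii) real zeros of odd multiplicity
      (∀ q₀ : ℝ, (q₀ : ℂ) ∈ regionQ s →
        Odd ((G.chromaticPolynomial.map (Int.castRingHom ℝ)).rootMultiplicity q₀) →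
        ∀ ε > 0, ∀ᶠ p in Filter.atTop, ∃ q ∈ Set.Ioo (q₀ - ε) (q₀ + ε),
          Polynomial.aeval q (G' p).chromaticPolynomial = 0) := by
  classical
  have := hV.fintype
  have := hE.fintype
  choose a₀ b₀ hab₀ using fun e : E(G) ↦ G.exists_isLink_of_mem_edgeSet e.2
  let a (e : E(G)) : V(G) := ⟨a₀ e, (hab₀ e).left_mem⟩
  let b (e : E(G)) : V(G) := ⟨b₀ e, (hab₀ e).right_mem⟩
  have hab (e : E(G)) : G.IsLink e (a e) (b e) := hab₀ e
  have hlim (K : Set ℂ) (hK : IsCompact K) (hKs : K ⊆ regionQ s) : TendstoUniformlyOn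
      (fun (p : ℕ) (q : ℂ) ↦ (Polynomial.aeval q (closedWalkPoly s) ^ (Fintype.card E(G) * p))⁻¹ *
        Polynomial.aeval q (Graph.inflate a b s p).chromaticPolynomial)
      (fun q ↦ Polynomial.aeval q G.chromaticPolynomial) Filter.atTop K := by
    -- The counting lemmas are indexed by the number s - 1 of interior vertices of a path.
    obtain ⟨s, rfl⟩ : ∃ s', s = s' + 1 := ⟨s - 1, by omega⟩
    exact Graph.tendstoUniformlyOn_inflate a b G (Equiv.refl _) (Equiv.refl _) hab s hK hKs
  have hC {q : ℂ} (hq : q ∈ regionQ s) : Polynomial.aeval q (closedWalkPoly s) ≠ 0 :=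
    norm_pos_iff.1 ((norm_nonneg _).trans_lt (norm_openWalk_lt hq))
  refine ⟨Graph.InflVertex V(G) E(G), Graph.InflEdge V(G) E(G), Graph.inflate a b s, Fintype.card E(G),
    fun p _ ↦ ?_, fun K hK hKs ↦ ?_, fun hconn p hp ↦ ?_, fun hs2 ⟨c, hc⟩ p _ ↦ ?_,
    fun S _ _ _ hemb p _ ↦ ?_, fun q₀ hq₀ h0 ε hε ↦ ?_, fun q₀ hq₀ hodd ε hε ↦ ?_⟩
  · obtain ⟨t, rfl⟩ : ∃ s', s = s' + 1 := ⟨s - 1, by omega⟩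
    exact ⟨Set.finite_coe_iff.1 (.of_equiv _ (Graph.inflVertexEquiv a b t p)),
      Set.finite_coe_iff.1 (.of_equiv _ (Graph.inflEdgeEquiv a b (t + 1) p)),
      Graph.inflate_isDegenerate hs, Graph.inflate_colorable_three hs⟩
  · refine (hlim K hK hKs).congr (.of_forall fun p q hq ↦ ?_)
    simp only
    rw [cycleFactor_eq fun h ↦ zero_notMem_regionQ (h ▸ hKs hq)]
  · have := hconn.nonempty
    exact Graph.inflate_isConnected hs hp (hconn.eqvGen hab)
  · exact Graph.inflate_isBipartite hs2 c fun e ↦ hc _ _ ⟨e, hab e⟩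
  · obtain ⟨D⟩ := hemb.exists_discDrawing hG hab
    exact Graph.inflate_embeddableOn (by omega) D
  · have := eventually_exists_zero_of_tendstoUniformlyOn (isOpen_regionQ s) (fun p ↦ ?_)
      (Polynomial.continuous_aeval _).continuousOn hlim hq₀ h0
      (Polynomial.eventually_aeval_ne_zero (G.chromaticPolynomial_ne_zero hV hE hG) q₀) hε
    · filter_upwards [this] with p ⟨q, hq, hlt, hz⟩
      exact ⟨q, hlt, (mul_eq_zero.1 hz).resolve_left (inv_ne_zero (pow_ne_zero _ (hC hq)))⟩
    · exact ((((closedWalkPoly s).differentiable_aeval).differentiableOn.pow _).inv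
        fun q hq ↦ pow_ne_zero _ (hC hq)).mul (Polynomial.differentiable_aeval _).differentiableOn
  · refine eventually_exists_real_zero (N := fun p ↦ Fintype.card E(G) * p) (isOpen_regionQ s) (fun q hq ↦ hC hq) (fun q hq ↦ ?_) hq₀
      hodd hε
    -- Pointwise convergence is uniform convergence on a one-point compact set.
    exact (hlim {q} isCompact_singleton (by simpa using hq)).tendsto_at rfl
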